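/- Let $n\ge 2$, $2\le r\le\infty$ (or $r=\omega$), and let $\overline M$ be a connected (Hausdorff, second countable) $C^r$ $n$-manifold-with-boundary. Let $g$ be a $C^1$ Lorentzian metric (signature $(-,+,\dots,+)$) on $\overline M$ whose restriction to $T_p\partial M$ is Lorentzian for every $p\in\partial M$ (negative definite if $n=2$), and let $(\overline M,g)$ be time-oriented, that is, one of the two causal cones is chosen at each point as the future one, locally selected by a continuous timelike vector field. A vector $v$ is causal if $v\neq 0$ and $g(v,v)\le 0$. A future-directed piecewise smooth causal curve is a continuous curve $\gamma:[a,b]\to\overline M$, $a<b$, with a partition of $[a,b]$ into closed intervals on each of which $\gamma$ is $C^r$ with future-directed causal velocity everywhere (one-sided at endpoints). A future-directed $H^1$-causal curve is a continuous curve $\gamma:[a,b]\to\overline M$, $a<b$, such that for every chart $(U,\varphi)$ and every compact interval $J\subset\gamma^{-1}(U)$ the curve $\varphi\circ\gamma|_J$ is absolutely continuous with square integrable derivative, and whose velocity is future-directed causal almost everywhere. For either class of curves, $J^+(p)$ (resp. $J^-(p)$) is the set consisting of $p$ and of all $q$ such that some future-directed causal curve of the class goes from $p$ to $q$ (resp.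 from $q$ to $p$); these sets are denoted $J^\pm_{ps}(p)$ and $J^\pm_{H^1}(p)$ respectively. $(\overline M,g)$ is globally hyperbolic with respect to the class if no causal curve of the class is closed (has equal endpoints) and $J^+(p)\cap J^-(q)$ is compact for all $p,q\in\overline M$. If $(\overline M,g)$ is globally hyperbolic with respect to piecewise smooth causal curves, then $J^{+}_{ps}(p)=J^{+}_{H^1}(p)$ and $J^{-}_{ps}(p)=J^{-}_{H^1}(p)$ for all $p\in\overline M$. Consequently, $(\overline M,g)$ is also globally hyperbolic with respect to $H^1$-causal curves. -/

import Mathlib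

open Set MeasureTheory
open scoped Manifold ContDiff Topology

namespace TimelikeBoundary

/-- A symmetric bilinear form `B` is Lorentzian (nondegenerate of signature `(-, +, …, +)`) on the
subspace `W`: some `v ∈ W` is timelike, and `B` is positive definite on the orthogonal complement
of `v` in `W`. If `W` is a line this says that `B` is negative definite on `W`. -/
def IsLorentzianOn {V : Type*} [AddCommGroup V] [Module ℝ V] (B : V → V → ℝ)
    (W : Submodule ℝ V) : Prop :=
  ∃ v ∈ W, B v v < 0 ∧ ∀ w ∈ W, B v w = 0 → w ≠ 0 → 0 < B w w

section

variable (n : ℕ) [NeZero n]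
variable (M : Type*) [TopologicalSpace M] [ChartedSpace (EuclideanHalfSpace n) M]

/-- A Lorentzian metric of class `C¹` on the `n`-manifold-with-boundary `M`. -/
structure LorentzMetric [IsManifold (𝓡∂ n) 1 M] where
  /-- The scalar product on each tangent space (`n`-dimensional also at boundary points). -/
  inner (p : M) : TangentSpace (𝓡∂ n) p →L[ℝ] TangentSpace (𝓡∂ n) p →L[ℝ] ℝ
  symm (p : M) (v w : TangentSpace (𝓡∂ n) p) : inner p v w = inner p w v
  lorentzian (p : M) : IsLorentzianOn (fun v w => inner p v w) ⊤
  contMDiff : ContMDiff (𝓡∂ n)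
    ((𝓡∂ n).prod 𝓘(ℝ, EuclideanSpace ℝ (Fin n) →L[ℝ] EuclideanSpace ℝ (Fin n) →L[ℝ] ℝ)) 1
    (fun p => Bundle.TotalSpace.mk'
      (EuclideanSpace ℝ (Fin n) →L[ℝ] EuclideanSpace ℝ (Fin n) →L[ℝ] ℝ) p (inner p))

end

variable {n : ℕ} [NeZero n]
variable {M : Type*} [TopologicalSpace M] [ChartedSpace (EuclideanHalfSpace n) M]

/-- The hyperplane `T_p ∂M` of `T_p M`, for a boundary point `p`: the vectors on which the
differential of the coordinate `x⁰` defining the boundary vanishes. -/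
noncomputable def boundaryTangent (p : M) : Submodule ℝ (TangentSpace (𝓡∂ n) p) :=
  LinearMap.ker ((EuclideanSpace.proj (0 : Fin n) : EuclideanSpace ℝ (Fin n) →L[ℝ] ℝ) ∘L
    (mfderiv (𝓡∂ n) 𝓘(ℝ, EuclideanSpace ℝ (Fin n)) (extChartAt (𝓡∂ n) p) p :
      TangentSpace (𝓡∂ n) p →L[ℝ] EuclideanSpace ℝ (Fin n))).toLinearMap

/-- The boundary is timelike: the metric induced on `∂M` is Lorentzian. -/
def LorentzMetric.HasTimelikeBoundary [IsManifold (𝓡∂ n) 1 M] (g : LorentzMetric n M) : Prop :=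
  ∀ p : M, (𝓡∂ n).IsBoundaryPoint p →
    IsLorentzianOn (fun v w => g.inner p v w) (boundaryTangent p)

/-- A time orientation: a choice, at each point, of one of the two causal cones, which is locally
selected by continuous timelike vector fields. -/
structure TimeOrientation [IsManifold (𝓡∂ n) 1 M] (g : LorentzMetric n M) where
  /-- The set of future-directed causal vectors. -/
  futureCone (p : M) : Set (TangentSpace (𝓡∂ n) p)
  locally_selected (p : M) : ∃ U : Set M, IsOpen U ∧ p ∈ U ∧
    ∃ X : ∀ q : M, TangentSpace (𝓡∂ n) q,
      ContinuousOn (fun q => (⟨q, X q⟩ : TangentBundle (𝓡∂ n) M)) U ∧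
      ∀ q ∈ U, g.inner q (X q) (X q) < 0 ∧
        futureCone q = {v | v ≠ 0 ∧ g.inner q v v ≤ 0 ∧ g.inner q (X q) v < 0}

/-- The velocity at time `t` of a curve defined on `[a, b]` (one-sided at the endpoints; it is
zero, hence not causal, if the curve is not differentiable there). -/
noncomputable def velocity (γ : ℝ → M) (a b t : ℝ) : TangentSpace (𝓡∂ n) (γ t) :=
  (mfderivWithin 𝓘(ℝ, ℝ) (𝓡∂ n) γ (Icc a b) t : ℝ →L[ℝ] TangentSpace (𝓡∂ n) (γ t)) 1

/-- `γ : [a, b] → M` is a future-directed causal curve which is piecewise of class `C^r`: it is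
`C^r` with future-directed causal velocity on each of the closed intervals of a partition. -/
def IsPSFutureCausal [IsManifold (𝓡∂ n) 1 M] {g : LorentzMetric n M} (o : TimeOrientation g)
    (r : ℕ∞ω) (γ : ℝ → M) (a b : ℝ) : Prop :=
  ∃ (m : ℕ) (t : ℕ → ℝ), t 0 = a ∧ t m = b ∧ ∀ i < m, t i < t (i + 1) ∧
    ContMDiffOn 𝓘(ℝ, ℝ) (𝓡∂ n) r γ (Icc (t i) (t (i + 1))) ∧
    ∀ s ∈ Icc (t i) (t (i + 1)), velocity γ (t i) (t (i + 1)) s ∈ o.futureCone (γ s)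

/-- The Sobolev space `H¹([c, d], ℝⁿ)`: absolutely continuous with square integrable derivative. -/
def IsH1 (f : ℝ → EuclideanSpace ℝ (Fin n)) (c d : ℝ) : Prop :=
  AbsolutelyContinuousOnInterval f c d ∧ MemLp (deriv f) 2 (volume.restrict (Icc c d))

/-- `γ : [a, b] → M` is an `H¹`-curve in the `C^r` manifold-with-boundary `M`: it is continuous,
and it is `H¹` in every chart, on every compact interval which it maps into the chart domain. -/
def IsH1Curve (r : ℕ∞ω) (γ : ℝ → M) (a b : ℝ) : Prop :=
  ContinuousOn γ (Icc a b) ∧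
    ∀ φ ∈ IsManifold.maximalAtlas (𝓡∂ n) r M, ∀ c d : ℝ, c ≤ d → Icc c d ⊆ Icc a b →
      MapsTo γ (Icc c d) φ.source → IsH1 (n := n) (φ.extend (𝓡∂ n) ∘ γ) c d

/-- `γ : [a, b] → M` is a future-directed `H¹`-causal curve. -/
def IsH1FutureCausal [IsManifold (𝓡∂ n) 1 M] {g : LorentzMetric n M} (o : TimeOrientation g)
    (r : ℕ∞ω) (γ : ℝ → M) (a b : ℝ) : Prop :=
  IsH1Curve (n := n) r γ a b ∧
    ∀ᵐ t ∂(volume.restrict (Icc a b)), velocity γ a b t ∈ o.futureCone (γ t)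

/-! Causal relations computed with a class `C` of future-directed causal curves, where `C γ a b`
means that the restriction of `γ` to `[a, b]` belongs to the class. -/

/-- `p < q`: some future-directed causal curve of the class `C` goes from `p` to `q`. -/
def CausalLT {X : Type*} (C : (ℝ → X) → ℝ → ℝ → Prop) (p q : X) : Prop :=
  ∃ (γ : ℝ → X) (a b : ℝ), a < b ∧ C γ a b ∧ γ a = p ∧ γ b = q

/-- `J⁺(p)`; it contains `p` by convention. -/
def JPlus {X : Type*} (C : (ℝ → X) → ℝ → ℝ → Prop) (p : X) : Set X :=
  {q | q = p ∨ CausalLT C p q}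

/-- `J⁻(p)`; it contains `p` by convention. -/
def JMinus {X : Type*} (C : (ℝ → X) → ℝ → ℝ → Prop) (p : X) : Set X :=
  {q | q = p ∨ CausalLT C q p}

/-- Global hyperbolicity: there are no closed causal curves, and all the sets `J⁺(p) ∩ J⁻(q)` are
compact. -/
def IsGloballyHyperbolic {X : Type*} [TopologicalSpace X] (C : (ℝ → X) → ℝ → ℝ → Prop) : Prop :=
  (∀ p : X, ¬ CausalLT C p p) ∧ ∀ p q : X, IsCompact (JPlus C p ∩ JMinus C q)

end TimelikeBoundary

/-!
Every piecewise smooth causal curve is Lipschitz in charts, hence an `H¹`-causal curve. The content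
is the converse for the causal relations: if an `H¹`-causal curve joins `p` to `q`, then so does a
piecewise smooth one, or `p = q`.

Around a point `p` choose a chart and a constant vector `V` which is timelike and future-directed
near `p` and which is tangent to the boundary if `p` lies on it; such a `V` exists because the
boundary is timelike (`exists_isCausalChart`). Segments in the chart with causal direction are
smooth causal curves (`IsCausalChart.mem_JPlus_of_segment`). As the metric is `C¹`, it is Lipschitz
in the chart. So a vector `v` which is causal at `x` becomes causal at `y` on adding `c V`, where
`c` is proportional to `|x - y| |v|` (`IsConeModel.add_smul_mem`). Let `f` be a short `H¹`-causal
curve in the chart and `Λ` its arc length. For `η > 0` the curve `f + η Λ V` stays at distance at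
most `η Λ |V|` from `f`, and because `Λ` is small, adding `η |f'| V` to `f'` more than compensates
for the change of the metric over this distance. Hence a fine inscribed polygon of `f + η Λ V` is
causal: its edges are integrals of vectors in a fixed closed convex cone
(`IsConeModel.rel_add_smul`). It starts where `f` does, and stays in the half-space as `V` is
tangent to the boundary. For `η → 0` its endpoint tends to that of `f`, so the end of `f` lies in
the closure of the causal future of its start.

In a globally hyperbolic manifold causal futures are closed (`isClosed_JPlus`): a limit point `q`
of `J⁺(p)` has a neighbourhood contained in some `J⁻(q')`, since one may move from `q` in the
direction of `V`, and `J⁺(p) ∩ J⁻(q')` is compact. So nearby points of an `H¹`-causal curve are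
related by piecewise smooth curves, and concatenation gives the same for all its points
(`IsH1FutureCausal.mem_JPlus_ps`). A closed `H¹`-causal curve is not constant, and would therefore
yield a closed piecewise smooth one.
-/

namespace TimelikeBoundary

/-! ### Lorentzian scalar products -/

section Algebra

variable {E : Type*} [NormedAddCommGroup E] [NormedSpace ℝ E]

/-- `B` is a Lorentzian scalar product and `V` is timelike: `B` is symmetric, `B V V < 0`, and `B`
is positive definite on the orthogonal complement of `V`. -/
structure IsLorentzianWith (B : E →L[ℝ] E →L[ℝ] ℝ) (V : E) : Prop where
  symm : ∀ v w, B v w = B w v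
  neg : B V V < 0
  pos : ∀ w, B V w = 0 → w ≠ 0 → 0 < B w w

/-- The closed cone of causal vectors in the time cone of the timelike vector `V`, together with
the zero vector. -/
def causalCone (B : E →L[ℝ] E →L[ℝ] ℝ) (V : E) : Set E :=
  {w | B w w ≤ 0 ∧ B V w ≤ 0}

variable {B : E →L[ℝ] E →L[ℝ] ℝ} {V X u v w : E}

namespace IsLorentzianWith

theorem eq_zero_of_causal_of_orthogonal (h : IsLorentzianWith B V) (hw : B w w ≤ 0)
    (hVw : B V w = 0) : w = 0 := by
  by_contra hne
  exact absurd (h.pos w hVw hne) (not_lt.2 hw)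

/-- The reverse Cauchy-Schwarz inequality, in qualitative form. -/
theorem apply_nonpos (h : IsLorentzianWith B V) (hu : u ∈ causalCone B V)
    (hw : w ∈ causalCone B V) : B u w ≤ 0 := by
  rcases eq_or_lt_of_le hu.2 with hu0 | hu0
  · rw [h.eq_zero_of_causal_of_orthogonal hu.1 hu0]; simp
  rcases eq_or_lt_of_le hw.2 with hw0 | hw0
  · rw [h.eq_zero_of_causal_of_orthogonal hw.1 hw0]; simp
  by_contra! hs
  -- this combination of `u` and `w` is orthogonal to `V`
  have hz : B V (B V w • u - B V u • w) = 0 := by simp [mul_comm]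
  have hz2 : 0 ≤ B (B V w • u - B V u • w) (B V w • u - B V u • w) := by
    by_cases h0 : B V w • u - B V u • w = 0
    · rw [h0]; simp
    · exact (h.pos _ hz h0).le
  simp only [map_sub, map_smul, sub_apply, smul_apply,
    smul_eq_mul, h.symm w u] at hz2
  have h1 := mul_pos (mul_pos_of_neg_of_neg hu0 hw0) hs
  have h2 : B V w * (B V w * B u u) ≤ 0 := by nlinarith [mul_self_nonneg (B V w), hu.1]
  have h3 : B V u * (B V u * B w w) ≤ 0 := by nlinarith [mul_self_nonneg (B V u), hw.1]
  nlinarith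

theorem of_timelike (h : IsLorentzianWith B V) (hX : B X X < 0) : IsLorentzianWith B X := by
  refine ⟨h.symm, hX, fun w hw hne => ?_⟩
  have hα : B V X ≠ 0 := fun h0 => by
    have := h.eq_zero_of_causal_of_orthogonal hX.le h0
    simp [this] at hX
  set β := B V w / B V X with hβ
  have hz : B V (w - β • X) = 0 := by simp [hβ, hα]
  have hzz : B (w - β • X) (w - β • X) = B w w + β ^ 2 * B X X := by
    simp only [map_sub, map_smul, sub_apply, smul_apply,
      smul_eq_mul, h.symm w X, hw]
    ring
  by_cases h0 : w - β • X = 0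
  · have hw' : w = β • X := sub_eq_zero.1 h0
    have hβ0 : β = 0 := by
      rw [hw'] at hw
      simpa [hX.ne] using hw
    exact absurd (by rw [hw', hβ0, zero_smul]) hne
  · have := h.pos _ hz h0
    nlinarith [mul_nonneg (sq_nonneg β) (neg_nonneg.2 hX.le)]

/-- Timelike vectors in the same time cone select the same causal vectors. -/
theorem apply_neg_iff (h : IsLorentzianWith B V) (hX : B X X < 0) (hVX : B V X < 0)
    (hv : B v v ≤ 0) (hne : v ≠ 0) : B X v < 0 ↔ B V v < 0 := by
  have hX' := h.of_timelike hX
  constructor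
  · intro hXv
    refine lt_of_le_of_ne (hX'.apply_nonpos ⟨h.neg.le, ?_⟩ ⟨hv, hXv.le⟩) fun h0 =>
      hne (h.eq_zero_of_causal_of_orthogonal hv h0)
    rw [h.symm]; exact hVX.le
  · intro hVv
    exact lt_of_le_of_ne (h.apply_nonpos ⟨hX.le, hVX.le⟩ ⟨hv, hVv.le⟩) fun h0 =>
      hne (hX'.eq_zero_of_causal_of_orthogonal hv h0)

theorem smul_mem (hu : u ∈ causalCone B V) {c : ℝ} (hc : 0 ≤ c) : c • u ∈ causalCone B V := by
  refine ⟨?_, by simpa using mul_nonpos_of_nonneg_of_nonpos hc hu.2⟩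
  simp only [map_smul, smul_apply, smul_eq_mul]
  exact mul_nonpos_of_nonneg_of_nonpos hc (mul_nonpos_of_nonneg_of_nonpos hc hu.1)

theorem self_mem (h : IsLorentzianWith B V) : V ∈ causalCone B V := ⟨h.neg.le, h.neg.le⟩

/-- The causal cone is its own dual cone, up to sign. -/
theorem mem_causalCone_of_forall (h : IsLorentzianWith B V)
    (hw : ∀ u ∈ causalCone B V, B u w ≤ 0) : w ∈ causalCone B V := by
  have hVw := hw V h.self_mem
  refine ⟨?_, hVw⟩
  by_contra! hpos
  set a := B V w / B V V with ha
  have ha0 : 0 ≤ a := div_nonneg_of_nonpos hVw h.neg.le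
  set y := w - a • V with hy
  have hVy : B V y = 0 := by simp [hy, ha, h.neg.ne]
  have hwy : w = y + a • V := by simp [hy]
  have hyV : B y V = 0 := by rw [h.symm]; exact hVy
  have hww : B w w = B y y + a ^ 2 * B V V := by
    rw [hwy]
    simp only [map_add, map_smul, add_apply, smul_apply,
      smul_eq_mul, hVy, hyV]
    ring
  have hc : 0 < -B V V := neg_pos.2 h.neg
  have hyy : 0 < B y y := by nlinarith [mul_nonneg (sq_nonneg a) hc.le]
  -- `y + l • V` is a null vector in the cone, and its product with `w` is positive
  set l := √(B y y / -B V V) with hl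
  have hl2 : l ^ 2 * -B V V = B y y := by
    rw [hl, Real.sq_sqrt (div_pos hyy hc).le, div_mul_cancel₀ _ hc.ne']
  have hl0 : 0 ≤ l := Real.sqrt_nonneg _
  have hal : a < l := by
    have : a ^ 2 < l ^ 2 := by
      by_contra! hh
      nlinarith [mul_le_mul_of_nonneg_right hh hc.le]
    exact lt_of_pow_lt_pow_left₀ 2 hl0 this
  have hu := hw (y + l • V) ⟨by
    simp only [map_add, map_smul, add_apply, smul_apply,
      smul_eq_mul, hVy, hyV]
    nlinarith, by
    simp only [map_add, map_smul, smul_eq_mul, hVy]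
    nlinarith⟩
  rw [hwy] at hu
  simp only [map_add, map_smul, add_apply, smul_apply,
      smul_eq_mul, hVy, hyV] at hu
  have hl00 : 0 < l := ha0.trans_lt hal
  have : 0 < l * (l - a) * -B V V := by have := sub_pos.2 hal; positivity
  nlinarith

end IsLorentzianWith

theorem isLorentzianWith_of_isLorentzianOn (hs : ∀ v w, B v w = B w v)
    (h : IsLorentzianOn (fun v w => B v w) (⊤ : Submodule ℝ E)) (hV : B V V < 0) :
    IsLorentzianWith B V := by
  obtain ⟨v, -, hv, hp⟩ := h
  exact IsLorentzianWith.of_timelike (V := v) ⟨hs, hv, fun w => hp w trivial⟩ hV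

end Algebra

/-! ### Cone fields on convex sets -/

section ConeModel

variable {E : Type*} [NormedAddCommGroup E] [NormedSpace ℝ E]

/-- Uniform control of a field `G` of Lorentzian scalar products on a convex set `S`: the constant
vector `V` is timelike, `G` is `K`-Lipschitz, the causal vectors make a definite angle with the
hyperplane orthogonal to `V`, and `S` is small with respect to these constants. -/
structure IsConeModel (G : E → E →L[ℝ] E →L[ℝ] ℝ) (V : E) (S : Set E) (K κ : ℝ) : Prop where
  convex : Convex ℝ S
  lorentz : ∀ x ∈ S, IsLorentzianWith (G x) V
  nonneg : 0 ≤ K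
  pos : 0 < κ
  lipschitz : ∀ x ∈ S, ∀ y ∈ S, ∀ v w, |G x v w - G y v w| ≤ K * ‖x - y‖ * ‖v‖ * ‖w‖
  transverse : ∀ x ∈ S, ∀ v ∈ causalCone (G x) V, G x V v ≤ -κ * ‖v‖
  small : ∀ x ∈ S, ∀ y ∈ S, K * ‖x - y‖ * ‖V‖ ≤ κ / 2

variable {G : E → E →L[ℝ] E →L[ℝ] ℝ} {V : E} {S : Set E} {K κ : ℝ}

/-- Tilting a causal vector at `x` towards `V`, by an amount proportional to the distance from `x`
to `y`, makes it causal at `y`. -/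
theorem IsConeModel.add_smul_mem (h : IsConeModel G V S K κ) {x y v : E} (hx : x ∈ S) (hy : y ∈ S)
    (hv : v ∈ causalCone (G x) V) {c : ℝ} (hc : K / κ * ‖x - y‖ * ‖v‖ ≤ c) :
    v + c • V ∈ causalCone (G y) V := by
  have h1 := (abs_le.1 (h.lipschitz x hx y hy v v)).1
  have h2 := (abs_le.1 (h.lipschitz x hx y hy V v)).1
  have h3 := h.transverse x hx v hv
  have h4 := mul_le_mul_of_nonneg_right (h.small x hx y hy) (norm_nonneg v)
  have h5 : K * ‖x - y‖ * ‖v‖ ≤ κ * c := by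
    have := mul_le_mul_of_nonneg_left hc h.pos.le
    rwa [show κ * (K / κ * ‖x - y‖ * ‖v‖) = K * ‖x - y‖ * ‖v‖ by
      field_simp [h.pos.ne']] at this
  have hc0 : 0 ≤ c := le_trans (by have := h.nonneg; have := h.pos; positivity) hc
  have hL := h.lorentz y hy
  have h6 : G y V v ≤ -(κ / 2) * ‖v‖ := by linarith
  have hvn := norm_nonneg v
  refine ⟨?_, ?_⟩
  · simp only [map_add, map_smul, add_apply, smul_apply,
      smul_eq_mul, hL.symm v V]
    have h7 := mul_le_mul_of_nonneg_left h6 hc0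
    have h8 : c * (c * G y V V) ≤ 0 :=
      mul_nonpos_of_nonneg_of_nonpos hc0 (mul_nonpos_of_nonneg_of_nonpos hc0 hL.neg.le)
    have h9 := mul_le_mul_of_nonneg_right h5 hvn
    nlinarith [hv.1]
  · simp only [map_add, map_smul, smul_eq_mul]
    have := mul_nonpos_of_nonneg_of_nonpos hc0 hL.neg.le
    have : 0 ≤ κ / 2 * ‖v‖ := by have := h.pos; positivity
    linarith

/-- Near a point, a `C¹` field of scalar products is a cone model with respect to a vector which is
timelike at this point. -/
theorem exists_isConeModel [FiniteDimensional ℝ E] {R : Set E} (hR : Convex ℝ R) {x₀ : E}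
    (hG : ContDiffWithinAt ℝ 1 G R x₀)
    (hs : ∀ᶠ x in 𝓝[R] x₀, ∀ v w, G x v w = G x w v) (hL : IsLorentzianWith (G x₀) V) :
    ∃ K κ ρ : ℝ, 0 < ρ ∧ IsConeModel G V (R ∩ Metric.ball x₀ ρ) K κ := by
  obtain ⟨K, t, ht, hK⟩ := hG.exists_lipschitzOnWith hR
  have hcont : ContinuousWithinAt G R x₀ := hG.continuousWithinAt
  -- the quadratic form `P x` is positive definite at `x₀`, hence uniformly near `x₀`
  set Λ : ℝ := 2 / -G x₀ V V with hΛ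
  have hΛ0 : 0 < Λ := div_pos two_pos (neg_pos.2 hL.neg)
  let P : E → E → ℝ := fun x v => G x v v + Λ * (G x V v) ^ 2
  have hPpos : ∀ v, v ≠ 0 → 0 < P x₀ v := by
    intro v hv
    set a := G x₀ V v / G x₀ V V with ha
    set y := v - a • V with hy
    have hVy : G x₀ V y = 0 := by simp [hy, ha, hL.neg.ne]
    have hvy : v = y + a • V := by simp [hy]
    have hyV : G x₀ y V = 0 := by rw [hL.symm]; exact hVy
    have hVv : G x₀ V v = a * G x₀ V V := by rw [ha]; field_simp [hL.neg.ne]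
    have hP : P x₀ v = G x₀ y y + a ^ 2 * -G x₀ V V := by
      have h1 : G x₀ v v = G x₀ y y + a ^ 2 * G x₀ V V := by
        rw [hvy]
        simp only [map_add, map_smul, add_apply,
          smul_apply, smul_eq_mul, hVy, hyV]
        ring
      have h2 : Λ * -G x₀ V V = 2 := by
        rw [hΛ, div_mul_cancel₀ _ (neg_pos.2 hL.neg).ne']
      simp only [P]
      rw [h1, hVv]
      linear_combination (-a ^ 2 * G x₀ V V) * h2
    rw [hP]
    by_cases hy0 : y = 0
    · have ha0 : a ≠ 0 := fun h0 => hv (by rw [hvy, hy0, h0]; simp)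
      have := neg_pos.2 hL.neg
      rw [hy0]
      simp only [map_zero, zero_add]
      positivity
    · have := neg_pos.2 hL.neg
      have := hL.pos y hVy hy0
      positivity
  obtain ⟨m, hm, hPm⟩ : ∃ m > 0, ∀ v, ‖v‖ = 1 → m ≤ P x₀ v := by
    rcases (Metric.sphere (0 : E) 1).eq_empty_or_nonempty with he | hne
    · refine ⟨1, one_pos, fun v hv => ?_⟩
      have : v ∈ Metric.sphere (0 : E) 1 := by simpa using hv
      simp [he] at this
    · obtain ⟨v₀, hv₀, hmin⟩ := (isCompact_sphere (0 : E) 1).exists_isMinOn hne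
        (f := P x₀) (by fun_prop)
      refine ⟨P x₀ v₀, hPpos v₀ ?_, fun v hv => hmin (by simpa using hv)⟩
      rintro rfl
      simp at hv₀
  -- continuity of `P` in `x`, uniformly on the unit sphere
  have hunif : ∀ᶠ x in 𝓝[R] x₀, ∀ v, ‖v‖ = 1 → m / 2 ≤ P x v := by
    let c : (E →L[ℝ] E →L[ℝ] ℝ) → ℝ := fun L =>
      dist L (G x₀) + Λ * (dist L (G x₀) * ‖V‖ * ((dist L (G x₀) + 2 * ‖G x₀‖) * ‖V‖))
    have hc : Continuous c :=
      (continuous_id.dist continuous_const).add (continuous_const.mul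
        (((continuous_id.dist continuous_const).mul continuous_const).mul
          (((continuous_id.dist continuous_const).add continuous_const).mul continuous_const)))
    have hc0 : c (G x₀) = 0 := by simp [c]
    have hc1 : Filter.Tendsto (fun x => c (G x)) (𝓝[R] x₀) (𝓝 0) :=
      hc0 ▸ (hc.tendsto _).comp hcont.tendsto
    filter_upwards [hc1.eventually (gt_mem_nhds (half_pos hm))] with x hx v hv
    have hA : |G x v v - G x₀ v v| ≤ ‖G x - G x₀‖ := by
      have := (G x - G x₀).le_opNorm₂ v v
      simpa [hv] using this
    have hB : |G x V v - G x₀ V v| ≤ ‖G x - G x₀‖ * ‖V‖ := by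
      have := (G x - G x₀).le_opNorm₂ V v
      simpa [hv] using this
    have hC : |G x V v + G x₀ V v| ≤ (‖G x - G x₀‖ + 2 * ‖G x₀‖) * ‖V‖ := by
      have h2 := (G x₀).le_opNorm₂ V v
      rw [hv, mul_one, Real.norm_eq_abs] at h2
      calc |G x V v + G x₀ V v| = |(G x V v - G x₀ V v) + 2 * G x₀ V v| := by ring_nf
        _ ≤ |G x V v - G x₀ V v| + |2 * G x₀ V v| := abs_add_le _ _
        _ ≤ _ := by rw [abs_mul, abs_two]; linarith
    have hD : |(G x V v) ^ 2 - (G x₀ V v) ^ 2| ≤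
        ‖G x - G x₀‖ * ‖V‖ * ((‖G x - G x₀‖ + 2 * ‖G x₀‖) * ‖V‖) := by
      rw [sq_sub_sq, abs_mul, mul_comm]
      exact mul_le_mul hB hC (abs_nonneg _) (by positivity)
    have h1 := (abs_le.1 hA).1
    have h2 := mul_le_mul_of_nonneg_left (abs_le.1 hD).1 hΛ0.le
    have h3 := hPm v hv
    simp only [P] at h3 ⊢
    have hd' : dist (G x) (G x₀) = ‖G x - G x₀‖ := dist_eq_norm (G x) (G x₀)
    simp only [c, hd'] at hx
    linarith
  have hneg : ∀ᶠ x in 𝓝[R] x₀, G x V V < 0 := by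
    have : ContinuousWithinAt (fun x => G x V V) R x₀ := by fun_prop
    exact this.tendsto.eventually (gt_mem_nhds hL.neg)
  set κ := √(m / 2 / Λ) with hκ
  have hκ0 : 0 < κ := Real.sqrt_pos.2 (by positivity)
  obtain ⟨ρ, hρ, hρs⟩ : ∃ ρ > 0, ∀ x ∈ R ∩ Metric.ball x₀ ρ, x ∈ t ∧
      (∀ v w, G x v w = G x w v) ∧ (∀ v, ‖v‖ = 1 → m / 2 ≤ P x v) ∧ G x V V < 0 := by
    obtain ⟨ρ, hρ, h⟩ := Metric.mem_nhdsWithin_iff.1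
      ((Filter.eventually_mem_set.2 ht).and (hs.and (hunif.and hneg)))
    exact ⟨ρ, hρ, fun x hx => h ⟨hx.2, hx.1⟩⟩
  have hP2 : ∀ x ∈ R ∩ Metric.ball x₀ ρ, ∀ v, m / 2 * ‖v‖ ^ 2 ≤ P x v := by
    intro x hx v
    by_cases hv : v = 0
    · simp [hv, P]
    have hn : ‖v‖ ≠ 0 := norm_ne_zero_iff.2 hv
    have h1 := (hρs x hx).2.2.1 (‖v‖⁻¹ • v) (by rw [norm_smul, norm_inv, norm_norm]; field_simp)
    have h2 : P x (‖v‖⁻¹ • v) = (‖v‖ ^ 2)⁻¹ * P x v := by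
      simp only [P, map_smul, smul_apply, smul_eq_mul]
      field_simp
    rw [h2] at h1
    have h3 := mul_le_mul_of_nonneg_right h1 (sq_nonneg ‖v‖)
    rwa [mul_right_comm, inv_mul_cancel₀ (pow_ne_zero 2 hn), one_mul] at h3
  set ρ' := min ρ (κ / (4 * (K * ‖V‖ + 1))) with hρ'
  have hKV : 0 ≤ K * ‖V‖ := by positivity
  have hsub : R ∩ Metric.ball x₀ ρ' ⊆ R ∩ Metric.ball x₀ ρ :=
    inter_subset_inter_right _ (Metric.ball_subset_ball (min_le_left _ _))
  refine ⟨K, κ, ρ', lt_min hρ (by positivity), hR.inter (convex_ball _ _), fun x hx => ?_,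
    K.2, hκ0, fun x hx y hy v w => ?_, fun x hx v hv => ?_, fun x hx y hy => ?_⟩
  · refine ⟨(hρs x (hsub hx)).2.1, (hρs x (hsub hx)).2.2.2, fun w hVw hw => ?_⟩
    have h1 := hP2 x (hsub hx) w
    simp only [P, hVw] at h1
    have : 0 < m / 2 * ‖w‖ ^ 2 := by
      have := norm_pos_iff.2 hw
      positivity
    nlinarith
  · have h1 := hK.dist_le_mul x (hρs x (hsub hx)).1 y (hρs y (hsub hy)).1
    rw [dist_eq_norm, dist_eq_norm] at h1
    have h2 := (G x - G y).le_opNorm₂ v w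
    simp only [sub_apply, Real.norm_eq_abs] at h2
    refine h2.trans ?_
    gcongr
  · have h1 := hP2 x (hsub hx) v
    simp only [P] at h1
    have h2 : m / 2 * ‖v‖ ^ 2 ≤ Λ * (G x V v) ^ 2 := by linarith [hv.1]
    have h3 : (κ * ‖v‖) ^ 2 ≤ (G x V v) ^ 2 := by
      rw [mul_pow, hκ, Real.sq_sqrt (by positivity), div_mul_eq_mul_div, div_le_iff₀ hΛ0]
      linarith
    have h4 := sq_le_sq.1 h3
    rw [abs_of_nonneg (by positivity), abs_of_nonpos hv.2] at h4
    linarith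
  · have h1 : ‖x - y‖ ≤ ρ' + ρ' := by
      rw [← dist_eq_norm]
      calc dist x y ≤ dist x x₀ + dist y x₀ := dist_triangle_right _ _ _
        _ ≤ ρ' + ρ' := add_le_add hx.2.le hy.2.le
    have h2 : ρ' * (4 * (K * ‖V‖ + 1)) ≤ κ := by
      rw [← le_div_iff₀ (by positivity)]
      exact min_le_right _ _
    have h3 : (K : ℝ) * ‖V‖ * ‖x - y‖ ≤ K * ‖V‖ * (ρ' + ρ') := mul_le_mul_of_nonneg_left h1 hKV
    have h4 : 0 < ρ' := lt_min hρ (by positivity)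
    nlinarith

end ConeModel

/-! ### Approximation of causal curves by polygons -/

/-- A reflexive and transitive relation between the points of a compact interval holds between its
endpoints if it holds locally. -/
theorem rel_of_locally_rel {R : ℝ → ℝ → Prop} (hrefl : ∀ t, R t t)
    (htrans : ∀ s t u, R s t → R t u → R s u) {a b : ℝ} (hab : a ≤ b)
    (h : ∀ t ∈ Icc a b, ∃ δ > 0, ∀ s ∈ Icc a b, ∀ u ∈ Icc a b, |s - t| < δ → |u - t| < δ →
      s ≤ u → R s u) : R a b := by
  choose! δ hδ hR using h
  obtain ⟨t, ht0, htm, ⟨m, hm⟩, hti⟩ := exists_monotone_Icc_subset_open_cover_Icc hab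
    (c := fun x : Icc a b => {s : Icc a b | |(s : ℝ) - x| < δ x})
    (fun x => isOpen_lt (by fun_prop) continuous_const)
    (fun x _ => mem_iUnion.2 ⟨x, by simp [hδ x x.2]⟩)
  have key : ∀ k, R a (t k) := by
    intro k
    induction k with
    | zero => rw [ht0]; exact hrefl a
    | succ k ih =>
      obtain ⟨i, hi⟩ := hti k
      have hle : t k ≤ t (k + 1) := htm (Nat.le_succ k)
      exact htrans _ _ _ ih (hR i i.2 _ (t k).2 _ (t (k + 1)).2 (hi ⟨le_rfl, hle⟩)
        (hi ⟨hle, le_rfl⟩) hle)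
  have := key m
  rwa [hm m le_rfl] at this

theorem _root_.AbsolutelyContinuousOnInterval.clm_comp {E F : Type*} [NormedAddCommGroup E]
    [NormedSpace ℝ E] [NormedAddCommGroup F] [NormedSpace ℝ F] (L : E →L[ℝ] F) {f : ℝ → E}
    {a b : ℝ} (hf : AbsolutelyContinuousOnInterval f a b) :
    AbsolutelyContinuousOnInterval (fun t => L (f t)) a b := by
  refine squeeze_zero (fun t => Finset.sum_nonneg fun i _ => dist_nonneg) (fun t => ?_)
    (by simpa using Filter.Tendsto.const_mul ‖L‖ hf)
  rw [Finset.mul_sum]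
  exact Finset.sum_le_sum fun i _ => L.dist_le_opNorm _ _

section

variable {E : Type*} [NormedAddCommGroup E] [NormedSpace ℝ E]
variable {G : E → E →L[ℝ] E →L[ℝ] ℝ} {V : E} {S : Set E} {K κ : ℝ}

theorem IsConeModel.mono (h : IsConeModel G V S K κ) {S' : Set E} (hS' : Convex ℝ S')
    (hsub : S' ⊆ S) : IsConeModel G V S' K κ where
  convex := hS'
  lorentz x hx := h.lorentz x (hsub hx)
  nonneg := h.nonneg
  pos := h.pos
  lipschitz x hx y hy := h.lipschitz x (hsub hx) y (hsub hy)
  transverse x hx := h.transverse x (hsub hx)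
  small x hx y hy := h.small x (hsub hx) y (hsub hy)

/-- A short absolutely continuous causal curve `f` in a cone model is approximated by causal
polygons, which start at the same point: the vertices of the polygons lie on the curve
`f + (η Λ) • V`, where `Λ` is the arc length of `f`. The relation `R` stands for causal
relatedness, and `R` is only required to contain the pairs of endpoints of causal segments. -/
theorem IsConeModel.rel_add_smul (h : IsConeModel G V S K κ) {R : E → E → Prop}
    (hrefl : ∀ x, R x x) (htrans : ∀ x y z, R x y → R y z → R x z)
    (hseg : ∀ x ∈ S, ∀ y ∈ S, (∀ z ∈ segment ℝ x y, y - x ∈ causalCone (G z) V) → R x y)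
    {f : ℝ → E} {c d : ℝ} (hcd : c ≤ d) (hf : AbsolutelyContinuousOnInterval f c d)
    (hint : IntervalIntegrable (deriv f) volume c d) (hfS : ∀ t ∈ Icc c d, f t ∈ S)
    (hdiff : ∀ᵐ t ∂volume.restrict (Icc c d),
      DifferentiableAt ℝ f t ∧ deriv f t ∈ causalCone (G (f t)) V)
    (hshort : K / κ * ‖V‖ * ∫ t in c..d, ‖deriv f t‖ ≤ 1 / 2) {η : ℝ} (hη : 0 < η)
    (htop : ∀ t ∈ Icc c d, ∀ l ∈ Icc 0 (η * ∫ t in c..d, ‖deriv f t‖), f t + l • V ∈ S) :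
    R (f c) (f d + (η * ∫ t in c..d, ‖deriv f t‖) • V) := by
  have hintn : IntervalIntegrable (fun t => ‖deriv f t‖) volume c d := hint.norm
  have hsub : ∀ s ∈ Icc c d, ∀ u ∈ Icc c d, IntervalIntegrable (fun t => ‖deriv f t‖) volume s u :=
    fun s hs u hu => hintn.mono_set (by
      rw [uIcc_of_le hcd]; exact uIcc_subset_Icc hs hu)
  set A : ℝ → ℝ := fun τ => ∫ t in c..τ, ‖deriv f t‖ with hA
  have hAc : A c = 0 := by simp [hA]
  have hcc : c ∈ Icc c d := ⟨le_rfl, hcd⟩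
  have hdd : d ∈ Icc c d := ⟨hcd, le_rfl⟩
  have hAdiff : ∀ s ∈ Icc c d, ∀ u ∈ Icc c d, A u - A s = ∫ t in s..u, ‖deriv f t‖ :=
    fun s hs u hu => intervalIntegral.integral_interval_sub_left (hsub c hcc u hu) (hsub c hcc s hs)
  have hAmono : ∀ s ∈ Icc c d, ∀ u ∈ Icc c d, s ≤ u → A s ≤ A u := fun s hs u hu hsu => by
    rw [← sub_nonneg, hAdiff s hs u hu]
    exact intervalIntegral.integral_nonneg hsu fun t _ => norm_nonneg _
  have hA0 : ∀ s ∈ Icc c d, 0 ≤ A s := fun s hs => hAc ▸ hAmono c hcc s hs hs.1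
  have hAcont : ContinuousOn A (Icc c d) := by
    rw [← uIcc_of_le hcd]
    exact intervalIntegral.continuousOn_primitive_interval
      (by rw [uIcc_of_le hcd]; exact (intervalIntegrable_iff_integrableOn_Icc_of_le hcd).1 hintn)
  have hfcont : ContinuousOn f (Icc c d) := by
    rw [← uIcc_of_le hcd]; exact hf.continuousOn
  set F : ℝ → E := fun τ => f τ + (η * A τ) • V with hF
  have hFcont : ContinuousOn F (Icc c d) :=
    hfcont.add ((continuousOn_const.mul hAcont).smul continuousOn_const)
  have hFS : ∀ t ∈ Icc c d, F t ∈ S := fun t ht =>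
    htop t ht _ ⟨mul_nonneg hη.le (hA0 t ht),
      mul_le_mul_of_nonneg_left (hAmono t ht d hdd ht.2) hη.le⟩
  have hC : 0 ≤ K / κ := div_nonneg h.nonneg h.pos.le
  have key : R (F c) (F d) := by
    refine rel_of_locally_rel (R := fun s u => R (F s) (F u)) (fun t => hrefl _)
      (fun s t u => htrans _ _ _) hcd fun t₀ ht₀ => ?_
    set δ := η / (8 * (K / κ + 1)) with hδ
    have hδ0 : 0 < δ := by positivity
    have hδ1 : K / κ * δ ≤ η / 8 := by
      rw [hδ, mul_div_assoc', div_le_div_iff₀ (by positivity) (by positivity)]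
      nlinarith
    obtain ⟨δ₁, hδ₁, h1⟩ := Metric.continuousOn_iff.1 hfcont t₀ ht₀ δ hδ0
    obtain ⟨δ₂, hδ₂, h2⟩ := Metric.continuousOn_iff.1 hFcont t₀ ht₀ δ hδ0
    refine ⟨min δ₁ δ₂, lt_min hδ₁ hδ₂, fun s hs u hu hst hut hsu => ?_⟩
    have hsu' : Icc s u ⊆ Icc c d := Icc_subset_Icc hs.1 hu.2
    refine hseg _ (hFS s hs) _ (hFS u hu) fun z hz => ?_
    have hzS : z ∈ S := h.convex.segment_subset (hFS s hs) (hFS u hu) hz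
    have hL := h.lorentz z hzS
    have hzF : ‖z - F t₀‖ < δ := by
      have := (convex_ball (F t₀) δ).segment_subset (h2 s hs (hst.trans_le (min_le_right _ _)))
        (h2 u hu (hut.trans_le (min_le_right _ _))) hz
      rwa [mem_ball_iff_norm] at this
    -- the velocities, tilted towards `V`, are all causal at the single point `z`; the edge of the
    -- polygon is their integral
    have htilt : ∀ᵐ t ∂volume.restrict (Icc s u), DifferentiableAt ℝ f t ∧
        deriv f t + (η * ‖deriv f t‖) • V ∈ causalCone (G z) V := by
      filter_upwards [ae_restrict_of_ae_restrict_of_subset hsu' hdiff,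
        ae_restrict_mem measurableSet_Icc] with t ht htsu
      refine ⟨ht.1, h.add_smul_mem (hfS t (hsu' htsu)) hzS ht.2 ?_⟩
      refine mul_le_mul_of_nonneg_right ?_ (norm_nonneg _)
      have hft : ‖f t - f t₀‖ < δ := by
        rw [← dist_eq_norm]
        refine h1 t (hsu' htsu) (lt_of_lt_of_le ?_ (min_le_left δ₁ δ₂))
        rw [abs_lt] at hst hut
        exact abs_lt.2 ⟨by linarith [htsu.1], by linarith [htsu.2]⟩
      have hFf : ‖f t₀ - F t₀‖ ≤ η * A d * ‖V‖ := by
        have : f t₀ - F t₀ = -((η * A t₀) • V) := by simp [hF]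
        rw [this, norm_neg, norm_smul, Real.norm_of_nonneg (mul_nonneg hη.le (hA0 _ ht₀))]
        have := hAmono t₀ ht₀ d hdd ht₀.2
        gcongr
      have hfz : ‖f t - z‖ ≤ δ + η * A d * ‖V‖ + δ := by
        have : f t - z = (f t - f t₀) + (f t₀ - F t₀) + (F t₀ - z) := by abel
        rw [this]
        refine (norm_add₃_le).trans ?_
        rw [norm_sub_rev (F t₀) z]
        linarith
      have h3 := mul_le_mul_of_nonneg_left hfz hC
      have h4 : η * (K / κ * ‖V‖ * A d) ≤ η * (1 / 2) := mul_le_mul_of_nonneg_left hshort hη.le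
      nlinarith
    refine hL.mem_causalCone_of_forall fun w hw => ?_
    have hac : AbsolutelyContinuousOnInterval (fun t => G z w (f t)) s u :=
      (hf.clm_comp (G z w)).mono (by rw [uIcc_of_le hcd, uIcc_of_le hsu]; exact hsu')
    have hFTC := hac.integral_deriv_eq_sub
    have hderiv : ∀ᵐ t ∂volume.restrict (Icc s u),
        deriv (fun t => G z w (f t)) t + η * G z w V * ‖deriv f t‖ ≤ 0 := by
      filter_upwards [htilt] with t ht
      have hd : deriv (fun t => G z w (f t)) t = G z w (deriv f t) :=
        ((G z w).hasFDerivAt.comp_hasDerivAt t ht.1.hasDerivAt).deriv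
      have := hL.apply_nonpos hw ht.2
      simp only [map_add, map_smul, smul_eq_mul] at this
      rw [hd]
      linarith
    have hle : ∫ t in s..u, (deriv (fun t => G z w (f t)) t + η * G z w V * ‖deriv f t‖) ≤ 0 := by
      rw [intervalIntegral.integral_of_le hsu]
      exact setIntegral_nonpos_of_ae_restrict (ae_restrict_of_ae_restrict_of_subset
        Ioc_subset_Icc_self hderiv)
    rw [intervalIntegral.integral_add hac.intervalIntegrable_deriv
      ((hsub s hs u hu).const_mul _), hFTC, intervalIntegral.integral_const_mul,
      ← hAdiff s hs u hu] at hle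
    have hFF : F u - F s = (f u - f s) + (η * (A u - A s)) • V := by
      simp only [hF]; rw [mul_sub, sub_smul]; abel
    rw [hFF]
    simp only [map_add, map_sub, map_smul, smul_eq_mul]
    linarith
  have hFc : F c = f c := by simp [hF, hAc]
  rwa [hFc] at key

end

/-! ### The metric and the causal cones in a chart -/

section Chart

variable {n : ℕ} [NeZero n]
variable {M : Type*} [TopologicalSpace M] [ChartedSpace (EuclideanHalfSpace n) M]

/-- The differential at `q` of the preferred chart at `p`. -/
noncomputable def chartDeriv (p q : M) :
    TangentSpace (𝓡∂ n) q →L[ℝ] EuclideanSpace ℝ (Fin n) :=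
  mfderiv (𝓡∂ n) 𝓘(ℝ, EuclideanSpace ℝ (Fin n)) (extChartAt (𝓡∂ n) p) q

variable [IsManifold (𝓡∂ n) 1 M]

/-- The metric in the preferred chart at `p`, as a field of bilinear forms on `ℝⁿ`. -/
noncomputable def chartMetric (g : LorentzMetric n M) (p : M) (x : EuclideanSpace ℝ (Fin n)) :
    EuclideanSpace ℝ (Fin n) →L[ℝ] EuclideanSpace ℝ (Fin n) →L[ℝ] ℝ :=
  ContinuousLinearMap.inCoordinates (EuclideanSpace ℝ (Fin n)) (TangentSpace (𝓡∂ n))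
    (EuclideanSpace ℝ (Fin n) →L[ℝ] ℝ) (fun q : M => TangentSpace (𝓡∂ n) q →L[ℝ] ℝ)
    p ((extChartAt (𝓡∂ n) p).symm x) p ((extChartAt (𝓡∂ n) p).symm x)
    (g.inner ((extChartAt (𝓡∂ n) p).symm x))

theorem contDiffWithinAt_chartMetric (g : LorentzMetric n M) (p : M) :
    ContDiffWithinAt ℝ 1 (chartMetric g p) (range (𝓡∂ n)) (extChartAt (𝓡∂ n) p p) := by
  have h1 := ((contMDiffAt_hom_bundle _).1 (g.contMDiff p)).2
  have h2 : ContMDiffWithinAt 𝓘(ℝ, EuclideanSpace ℝ (Fin n)) (𝓡∂ n) 1 (extChartAt (𝓡∂ n) p).symm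
      (range (𝓡∂ n)) (extChartAt (𝓡∂ n) p p) := contMDiffWithinAt_extChartAt_symm_range_self p
  rw [← contMDiffWithinAt_iff_contDiffWithinAt]
  exact ContMDiffAt.comp_contMDiffWithinAt_of_eq h1 h2 (extChartAt_to_inv p)

theorem chartMetric_apply (g : LorentzMetric n M) {p q : M}
    (hq : q ∈ (extChartAt (𝓡∂ n) p).source) (v w : TangentSpace (𝓡∂ n) q) :
    chartMetric g p (extChartAt (𝓡∂ n) p q) (chartDeriv p q v) (chartDeriv p q w) =
      g.inner q v w := by
  have hq' : q ∈ (chartAt (EuclideanHalfSpace n) p).source := by rwa [← extChartAt_source (𝓡∂ n)]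
  have hb : q ∈ (trivializationAt (EuclideanSpace ℝ (Fin n)) (TangentSpace (𝓡∂ n)) p).baseSet := by
    simpa using hq'
  have hs : ∀ v : TangentSpace (𝓡∂ n) q,
      (trivializationAt (EuclideanSpace ℝ (Fin n)) (TangentSpace (𝓡∂ n)) p).symm q
        (chartDeriv p q v) = v := by
    intro v
    have h := TangentBundle.continuousLinearMapAt_trivializationAt (I := 𝓡∂ n) hq'
    have : chartDeriv p q v = (trivializationAt (EuclideanSpace ℝ (Fin n))
        (TangentSpace (𝓡∂ n)) p).continuousLinearMapAt ℝ q v := by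
      rw [h]; rfl
    rw [this]
    rw [← Bundle.Trivialization.symmL_apply (R := ℝ) _ hb]
    exact Bundle.Trivialization.symmL_continuousLinearMapAt (R := ℝ) _ hb v
  unfold chartMetric
  rw [(extChartAt (𝓡∂ n) p).left_inv hq]
  rw [inCoordinates_apply_eq₂ hb hb (mem_univ _), hs, hs]
  simp

theorem chartDeriv_surjective {p q : M} (hq : q ∈ (extChartAt (𝓡∂ n) p).source) :
    Function.Surjective (chartDeriv (n := n) p q) :=
  (isInvertible_mfderiv_extChartAt (I := 𝓡∂ n) hq).bijective.2

theorem chartDeriv_injective {p q : M} (hq : q ∈ (extChartAt (𝓡∂ n) p).source) :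
    Function.Injective (chartDeriv (n := n) p q) :=
  (isInvertible_mfderiv_extChartAt (I := 𝓡∂ n) hq).bijective.1

/-- The vector field `X` on `M`, continuous at `p`, is continuous at `p` in the chart. -/
theorem continuousAt_chartDeriv {p : M} {X : ∀ q : M, TangentSpace (𝓡∂ n) q}
    (hX : ContinuousAt (fun q => (⟨q, X q⟩ : TangentBundle (𝓡∂ n) M)) p) :
    ContinuousAt (fun q => chartDeriv p q (X q)) p := by
  have h1 := (FiberBundle.continuousAt_totalSpace (EuclideanSpace ℝ (Fin n)) _).1 hX
  refine h1.2.congr ?_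
  filter_upwards [extChartAt_source_mem_nhds (I := 𝓡∂ n) p] with q hq
  have hq' : q ∈ (chartAt (EuclideanHalfSpace n) p).source := by rwa [← extChartAt_source (𝓡∂ n)]
  have hb : q ∈ (trivializationAt (EuclideanSpace ℝ (Fin n)) (TangentSpace (𝓡∂ n)) p).baseSet := by
    simpa using hq'
  have h := TangentBundle.continuousLinearMapAt_trivializationAt (I := 𝓡∂ n) hq'
  have : chartDeriv p q (X q) = (trivializationAt (EuclideanSpace ℝ (Fin n))
      (TangentSpace (𝓡∂ n)) p).continuousLinearMapAt ℝ q (X q) := by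
    rw [h]; rfl
  rw [this, Bundle.Trivialization.continuousLinearMapAt_apply_of_mem (R := ℝ) (hb := hb)]

/-- A neighbourhood of `p`, given by a ball of radius `ρ` in the preferred chart at `p`, in which
the constant vector `V` is timelike and future-directed and points into the manifold, and in which
the future causal cones are those of a cone model. -/
structure IsCausalChart {g : LorentzMetric n M} (o : TimeOrientation g) (p : M)
    (V : EuclideanSpace ℝ (Fin n)) (ρ K κ : ℝ) : Prop where
  pos : 0 < ρ
  model : IsConeModel (chartMetric g p) V
    (range (𝓡∂ n) ∩ Metric.ball (extChartAt (𝓡∂ n) p p) ρ) K κ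
  subset_target : range (𝓡∂ n) ∩ Metric.ball (extChartAt (𝓡∂ n) p p) ρ ⊆
    (extChartAt (𝓡∂ n) p).target
  add_smul_mem : ∀ x ∈ range (𝓡∂ n), ∀ l : ℝ, 0 ≤ l →
    x + l • V ∈ Metric.ball (extChartAt (𝓡∂ n) p p) ρ → x + l • V ∈ range (𝓡∂ n)
  mem_futureCone : ∀ q ∈ (extChartAt (𝓡∂ n) p).source,
    extChartAt (𝓡∂ n) p q ∈ Metric.ball (extChartAt (𝓡∂ n) p p) ρ →
    ∀ v : TangentSpace (𝓡∂ n) q, v ∈ o.futureCone q ↔ chartDeriv p q v ≠ 0 ∧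
      chartDeriv p q v ∈ causalCone (chartMetric g p (extChartAt (𝓡∂ n) p q)) V

/-- In the time cone of any timelike vector `X` there is a timelike vector which is tangent to the
boundary, if the point lies on the boundary. -/
theorem exists_timelike {g : LorentzMetric n M} (hg : g.HasTimelikeBoundary) (p : M)
    {X : TangentSpace (𝓡∂ n) p} (hX : g.inner p X X < 0) :
    ∃ V : TangentSpace (𝓡∂ n) p, g.inner p V V < 0 ∧ g.inner p V X < 0 ∧
      ((𝓡∂ n).IsBoundaryPoint p → V ∈ boundaryTangent p) := by
  have key : ∀ V : TangentSpace (𝓡∂ n) p, g.inner p V V < 0 → g.inner p V X ≠ 0 := by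
    intro V hV h0
    have hL := isLorentzianWith_of_isLorentzianOn (E := EuclideanSpace ℝ (Fin n))
      (B := g.inner p) (g.symm p) (g.lorentzian p) hV
    have := hL.eq_zero_of_causal_of_orthogonal hX.le h0
    subst this
    exact hX.ne (map_zero _)
  obtain ⟨V, hV, hVb⟩ : ∃ V : TangentSpace (𝓡∂ n) p, g.inner p V V < 0 ∧
      ((𝓡∂ n).IsBoundaryPoint p → V ∈ boundaryTangent p) := by
    by_cases hb : (𝓡∂ n).IsBoundaryPoint p
    · obtain ⟨V, hV, hV', -⟩ := hg p hb
      exact ⟨V, hV', fun _ => hV⟩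
    · exact ⟨X, hX, fun h => absurd h hb⟩
  rcases lt_or_gt_of_ne (key V hV) with h | h
  · exact ⟨V, hV, h, hVb⟩
  · refine ⟨-V, by simpa using hV, by simpa using h, fun hb => neg_mem (hVb hb)⟩

theorem exists_isCausalChart {g : LorentzMetric n M} (hg : g.HasTimelikeBoundary)
    (o : TimeOrientation g) (p : M) : ∃ V ρ K κ, IsCausalChart o p V ρ K κ := by
  obtain ⟨U, hU, hpU, X, hXc, hX⟩ := o.locally_selected p
  obtain ⟨V₀, hV₀, hVX, hVb⟩ := exists_timelike hg p (hX p hpU).1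
  have hp := mem_extChartAt_source (I := 𝓡∂ n) p
  set φ := extChartAt (𝓡∂ n) p with hφ
  set V := chartDeriv p p V₀ with hV
  have hsymm : ∀ x ∈ φ.target, ∀ v w, chartMetric g p x v w = chartMetric g p x w v := by
    intro x hx v w
    obtain ⟨v', rfl⟩ := chartDeriv_surjective (φ.map_target hx) v
    obtain ⟨w', rfl⟩ := chartDeriv_surjective (φ.map_target hx) w
    have h := φ.right_inv hx
    have h1 := chartMetric_apply g (φ.map_target hx) v' w'
    have h2 := chartMetric_apply g (φ.map_target hx) w' v'
    rw [← hφ, h] at h1 h2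
    rw [h1, h2, g.symm]
  have hL : IsLorentzianWith (chartMetric g p (φ p)) V := by
    have hLor : IsLorentzianOn (fun v w => chartMetric g p (φ p) v w) ⊤ := by
      obtain ⟨v, -, hv, hpos⟩ := g.lorentzian p
      refine ⟨chartDeriv p p v, trivial, ?_, fun w _ hw hne => ?_⟩
      · simp only [hφ, chartMetric_apply g hp]; exact hv
      · obtain ⟨w', rfl⟩ := chartDeriv_surjective hp w
        simp only [hφ, chartMetric_apply g hp] at hw ⊢
        refine hpos w' trivial hw ?_
        rintro rfl
        simp at hne
    refine isLorentzianWith_of_isLorentzianOn (hsymm _ (mem_extChartAt_target p)) hLor ?_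
    rw [hV, hφ, chartMetric_apply g hp]
    exact hV₀
  have htar : φ.target ∈ 𝓝[range (𝓡∂ n)] (φ p) := extChartAt_target_mem_nhdsWithin p
  obtain ⟨K, κ, ρ₁, hρ₁, hmodel⟩ := exists_isConeModel (𝓡∂ n).convex_range
    (contDiffWithinAt_chartMetric g p) (Filter.eventually_of_mem htar hsymm) hL
  -- the field selecting the future cones and `V` lie in the same cone near `p`
  have hXV : ∀ᶠ x in 𝓝[range (𝓡∂ n)] (φ p), φ.symm x ∈ U ∧
      chartMetric g p x V (chartDeriv p (φ.symm x) (X (φ.symm x))) < 0 := by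
    have hsym : Filter.Tendsto φ.symm (𝓝[range (𝓡∂ n)] (φ p)) (𝓝 p) := by
      have h : ContinuousAt φ.symm (φ p) := continuousAt_extChartAt_symm p
      have h' := h.tendsto
      rw [hφ, extChartAt_to_inv, ← hφ] at h'
      exact h'.mono_left nhdsWithin_le_nhds
    have hξ := (continuousAt_chartDeriv (hXc.continuousAt (hU.mem_nhds hpU))).tendsto.comp hsym
    have hG := (contDiffWithinAt_chartMetric g p).continuousWithinAt.tendsto
    have hGV : Filter.Tendsto (fun x => chartMetric g p x V
        (chartDeriv p (φ.symm x) (X (φ.symm x)))) (𝓝[range (𝓡∂ n)] (φ p))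
        (𝓝 (chartMetric g p (φ p) V (chartDeriv p p (X p)))) :=
      (isBoundedBilinearMap_apply.continuous.tendsto _).comp
        (((isBoundedBilinearMap_apply.continuous.tendsto _).comp
          (hG.prodMk_nhds (tendsto_const_nhds (x := V)))).prodMk_nhds hξ)
    refine (hsym.eventually (hU.mem_nhds hpU)).and (hGV.eventually (gt_mem_nhds ?_))
    rw [hV, hφ, chartMetric_apply g hp]
    exact hVX
  have hup : ∀ᶠ ρ in 𝓝[>] (0 : ℝ), ∀ x ∈ range (𝓡∂ n), ∀ l : ℝ, 0 ≤ l →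
      x + l • V ∈ Metric.ball (φ p) ρ → x + l • V ∈ range (𝓡∂ n) := by
    rcases (𝓡∂ n).isInteriorPoint_or_isBoundaryPoint p with hi | hb
    · obtain ⟨ρ, hρ, hsub⟩ := Metric.mem_nhds_iff.1 (mem_interior_iff_mem_nhds.1 hi)
      filter_upwards [Ioo_mem_nhdsGT hρ] with ρ' hρ' x _ l _ hx
      exact hsub (Metric.ball_subset_ball hρ'.2.le hx)
    · refine Filter.Eventually.of_forall fun ρ x hx l hl _ => ?_
      have hV0 : V 0 = 0 := hVb hb
      rw [range_modelWithCornersEuclideanHalfSpace] at hx ⊢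
      simpa [hV0] using hx
  obtain ⟨ρ₂, hρ₂, hsub₂⟩ := Metric.mem_nhdsWithin_iff.1
    ((Filter.eventually_mem_set.2 htar).and hXV)
  obtain ⟨ρ, ⟨hρu, hρ0, hρm⟩⟩ := (hup.and (Ioo_mem_nhdsGT (lt_min hρ₁ hρ₂))).exists
  have hsub₁ : range (𝓡∂ n) ∩ Metric.ball (φ p) ρ ⊆ range (𝓡∂ n) ∩ Metric.ball (φ p) ρ₁ :=
    inter_subset_inter_right _ (Metric.ball_subset_ball (hρm.le.trans (min_le_left _ _)))
  have hall : ∀ x ∈ range (𝓡∂ n) ∩ Metric.ball (φ p) ρ, x ∈ φ.target ∧ φ.symm x ∈ U ∧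
      chartMetric g p x V (chartDeriv p (φ.symm x) (X (φ.symm x))) < 0 := fun x hx =>
    hsub₂ ⟨Metric.ball_subset_ball (hρm.le.trans (min_le_right _ _)) hx.2, hx.1⟩
  refine ⟨V, ρ, K, κ, hρ0, hmodel.mono ((𝓡∂ n).convex_range.inter (convex_ball _ _)) hsub₁,
    fun x hx => (hall x hx).1, hρu, fun q hq hqρ v => ?_⟩
  have hqS : φ q ∈ range (𝓡∂ n) ∩ Metric.ball (φ p) ρ :=
    ⟨extChartAt_target_subset_range p (φ.map_source hq), hqρ⟩
  obtain ⟨-, hqU, hqV⟩ := hall _ hqS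
  rw [φ.left_inv hq] at hqU hqV
  have hLq := hmodel.lorentz _ (hsub₁ hqS)
  have hinj := chartDeriv_injective hq
  have hXq := (hX q hqU).1
  rw [(hX q hqU).2]
  rw [← chartMetric_apply g hq] at hXq
  simp only [mem_ofPred_eq, causalCone, ← chartMetric_apply g hq]
  have hne : v ≠ 0 ↔ chartDeriv p q v ≠ 0 := by
    rw [not_iff_not]
    exact ⟨fun h => by rw [h, map_zero], fun h => hinj (by rw [h, map_zero])⟩
  rw [hne]
  refine and_congr_right fun hv => and_congr_right fun hc => ?_
  rw [hLq.apply_neg_iff hXq hqV hc hv]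
  exact ⟨fun h => h.le, fun h => lt_of_le_of_ne h fun h0 =>
    hv (hLq.eq_zero_of_causal_of_orthogonal hc h0)⟩

end Chart

/-! ### Piecewise smooth causal curves -/

section PiecewiseSmooth

variable {n : ℕ} [NeZero n]
variable {M : Type*} [TopologicalSpace M] [ChartedSpace (EuclideanHalfSpace n) M]

/-- The velocity is zero by convention where the curve is not differentiable. -/
theorem mdifferentiableWithinAt_of_velocity_ne_zero {γ : ℝ → M} {a b t : ℝ}
    (h : velocity (n := n) γ a b t ≠ 0) :
    MDifferentiableWithinAt 𝓘(ℝ, ℝ) (𝓡∂ n) γ (Icc a b) t := by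
  by_contra hd
  refine h ?_
  unfold velocity
  rw [mfderivWithin_zero_of_not_mdifferentiableWithinAt hd]
  rfl

variable [IsManifold (𝓡∂ n) 1 M]

theorem hasDerivWithinAt_extChartAt_comp {γ : ℝ → M} {a b t : ℝ} {p : M}
    (hp : γ t ∈ (extChartAt (𝓡∂ n) p).source)
    (hd : MDifferentiableWithinAt 𝓘(ℝ, ℝ) (𝓡∂ n) γ (Icc a b) t) :
    HasDerivWithinAt (extChartAt (𝓡∂ n) p ∘ γ) (chartDeriv p (γ t) (velocity γ a b t))
      (Icc a b) t := by
  have hp' : γ t ∈ (chartAt (EuclideanHalfSpace n) p).source := by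
    rwa [← extChartAt_source (𝓡∂ n)]
  have h1 := (mdifferentiableAt_extChartAt (I := 𝓡∂ n) hp').hasMFDerivAt.comp_hasMFDerivWithinAt t
    hd.hasMFDerivWithinAt
  have h2 : HasFDerivWithinAt (extChartAt (𝓡∂ n) p ∘ γ) ((chartDeriv p (γ t)).comp
      (mfderivWithin 𝓘(ℝ, ℝ) (𝓡∂ n) γ (Icc a b) t : ℝ →L[ℝ] TangentSpace (𝓡∂ n) (γ t)))
      (Icc a b) t := hasMFDerivWithinAt_iff_hasFDerivWithinAt.1 h1
  exact h2.hasDerivWithinAt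

theorem zero_notMem_futureCone {g : LorentzMetric n M} (o : TimeOrientation g) (p : M) :
    (0 : TangentSpace (𝓡∂ n) p) ∉ o.futureCone p := by
  obtain ⟨U, -, hpU, X, -, hX⟩ := o.locally_selected p
  rw [(hX p hpU).2]
  exact fun h => h.1 rfl

variable {g : LorentzMetric n M} {o : TimeOrientation g} {r : ℕ∞ω}

theorem IsPSFutureCausal.of_contMDiffOn {γ : ℝ → M} {a b : ℝ} (hab : a < b)
    (h : ContMDiffOn 𝓘(ℝ, ℝ) (𝓡∂ n) r γ (Icc a b))
    (hv : ∀ s ∈ Icc a b, velocity γ a b s ∈ o.futureCone (γ s)) :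
    IsPSFutureCausal o r γ a b := by
  refine ⟨1, fun i => if i = 0 then a else b, rfl, rfl, fun i hi => ?_⟩
  obtain rfl : i = 0 := by omega
  exact ⟨hab, h, hv⟩

/-- Invariance of future-directedness under translation of the parameter. Equality on the interval
is enough, because velocities at the endpoints are one-sided. -/
theorem velocity_mem_futureCone_of_eqOn {γ γ' : ℝ → M} {u v k : ℝ} (huv : u < v)
    (hk : EqOn γ' (fun s => γ (s - k)) (Icc (u + k) (v + k)))
    {s : ℝ} (hs : s ∈ Icc (u + k) (v + k))
    (h : velocity γ u v (s - k) ∈ o.futureCone (γ (s - k))) :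
    velocity γ' (u + k) (v + k) s ∈ o.futureCone (γ' s) := by
  have hd : MDifferentiableWithinAt 𝓘(ℝ, ℝ) (𝓡∂ n) γ (Icc u v) (s - k) :=
    mdifferentiableWithinAt_of_velocity_ne_zero
      fun h0 => zero_notMem_futureCone o _ (h0 ▸ h)
  have hsub : HasMFDerivWithinAt 𝓘(ℝ, ℝ) 𝓘(ℝ, ℝ) (fun s : ℝ => s - k) (Icc (u + k) (v + k)) s
      (ContinuousLinearMap.id ℝ ℝ) :=
    ((hasFDerivAt_id s).sub_const k).hasFDerivWithinAt.hasMFDerivWithinAt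
  have hmaps : Icc (u + k) (v + k) ⊆ (fun s : ℝ => s - k) ⁻¹' Icc u v :=
    fun t ht => ⟨by linarith [ht.1], by linarith [ht.2]⟩
  have h1 := HasMFDerivWithinAt.comp s hd.hasMFDerivWithinAt hsub hmaps
  have h2 := HasMFDerivWithinAt.congr_mono h1 (fun t ht => hk ht) (hk hs) Subset.rfl
  have hu : UniqueMDiffWithinAt 𝓘(ℝ, ℝ) (Icc (u + k) (v + k)) s :=
    (uniqueDiffOn_Icc (by linarith) s hs).uniqueMDiffWithinAt
  have h3 := h2.mfderivWithin hu
  have key : ∀ q q' : M, q = q' → ∀ w : EuclideanSpace ℝ (Fin n),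
      (w : TangentSpace (𝓡∂ n) q) ∈ o.futureCone q →
      (w : TangentSpace (𝓡∂ n) q') ∈ o.futureCone q' := by
    rintro q _ rfl w hw; exact hw
  unfold velocity
  rw [h3]
  exact key _ _ (hk hs).symm _ h

/-- Concatenation of piecewise smooth causal curves. -/
theorem IsPSFutureCausal.concat {γ₁ γ₂ : ℝ → M} {a b c d : ℝ}
    (h₁ : IsPSFutureCausal o r γ₁ a b) (h₂ : IsPSFutureCausal o r γ₂ c d) (h : γ₁ b = γ₂ c) :
    IsPSFutureCausal o r (fun s => if s ≤ b then γ₁ s else γ₂ (s - (b - c))) a (d + (b - c)) := by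
  obtain ⟨m₁, t₁, h₁a, h₁b, h₁⟩ := h₁
  obtain ⟨m₂, t₂, h₂c, h₂d, h₂⟩ := h₂
  have hle₁ : ∀ i, i ≤ m₁ → t₁ i ≤ b := by
    intro i hi
    induction hi using Nat.decreasingInduction with
    | self => exact h₁b.le
    | of_succ k hk ih => exact (h₁ k hk).1.le.trans ih
  have hle₂ : ∀ i, i ≤ m₂ → c ≤ t₂ i := by
    intro i
    induction i with
    | zero => intro _; exact h₂c.ge
    | succ k ih => exact fun hk => (ih (by omega)).trans (h₂ k hk).1.le
  set γ : ℝ → M := fun s => if s ≤ b then γ₁ s else γ₂ (s - (b - c)) with hγ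
  refine ⟨m₁ + m₂, fun i => if i ≤ m₁ then t₁ i else t₂ (i - m₁) + (b - c), by simp [h₁a], ?_,
    fun i hi => ?_⟩
  · by_cases hm : m₂ = 0
    · subst hm
      simp only [add_zero, le_refl, if_true, h₁b, ← h₂d, h₂c]
      ring
    · simp [hm, h₂d]
  by_cases hi₁ : i < m₁
  · obtain ⟨hlt, hs, hv⟩ := h₁ i hi₁
    simp only [hi₁.le, if_true, Nat.succ_le_of_lt hi₁]
    have heq : EqOn γ γ₁ (Icc (t₁ i) (t₁ (i + 1))) := fun s hs => by
      simp only [hγ, if_pos (hs.2.trans (hle₁ (i + 1) hi₁))]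
    refine ⟨hlt, hs.congr heq, fun s hs => ?_⟩
    have := velocity_mem_futureCone_of_eqOn (o := o) (γ := γ₁) (γ' := γ) (k := 0) hlt
      (by simpa using heq) (s := s) (by simpa using hs) (by rw [sub_zero]; exact hv s hs)
    simpa using this
  · obtain ⟨j, rfl⟩ := Nat.exists_eq_add_of_le (not_lt.1 hi₁)
    have hj : j < m₂ := by omega
    obtain ⟨hlt, hs, hv⟩ := h₂ j hj
    have e1 : (if m₁ + j ≤ m₁ then t₁ (m₁ + j) else t₂ (m₁ + j - m₁) + (b - c)) =
        t₂ j + (b - c) := by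
      by_cases hj0 : j = 0
      · subst hj0
        simp [h₁b, h₂c]
      · simp [hj0]
    have e2 : (if m₁ + j + 1 ≤ m₁ then t₁ (m₁ + j + 1) else t₂ (m₁ + j + 1 - m₁) + (b - c)) =
        t₂ (j + 1) + (b - c) := by
      rw [if_neg (by omega), show m₁ + j + 1 - m₁ = j + 1 by omega]
    simp only [e1, e2]
    have heq : EqOn γ (fun s => γ₂ (s - (b - c)))
        (Icc (t₂ j + (b - c)) (t₂ (j + 1) + (b - c))) := fun s hs => by
      have hsb : b ≤ s := by linarith [hle₂ j hj.le, hs.1]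
      rcases hsb.eq_or_lt with rfl | hsb
      · simp [hγ, h]
      · simp only [hγ, if_neg (not_le.2 hsb)]
    have hmaps : ∀ s ∈ Icc (t₂ j + (b - c)) (t₂ (j + 1) + (b - c)),
        s - (b - c) ∈ Icc (t₂ j) (t₂ (j + 1)) := fun s hs =>
      ⟨by linarith [hs.1], by linarith [hs.2]⟩
    refine ⟨by linarith, ?_, fun s hs =>
      velocity_mem_futureCone_of_eqOn hlt heq hs (hv _ (hmaps s hs))⟩
    refine (hs.comp (contDiff_id.sub contDiff_const).contMDiff.contMDiffOn hmaps).congr heq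

theorem CausalLT.trans_ps {p q s : M} (h₁ : CausalLT (IsPSFutureCausal o r) p q)
    (h₂ : CausalLT (IsPSFutureCausal o r) q s) : CausalLT (IsPSFutureCausal o r) p s := by
  obtain ⟨γ₁, a, b, hab, h₁, h₁a, h₁b⟩ := h₁
  obtain ⟨γ₂, c, d, hcd, h₂, h₂c, h₂d⟩ := h₂
  refine ⟨_, a, d + (b - c), by linarith, h₁.concat h₂ (h₁b.trans h₂c.symm), ?_, ?_⟩
  · simp [hab.le, h₁a]
  · rw [if_neg (by linarith), add_sub_cancel_right, h₂d]

theorem JPlus_trans_ps {p q s : M} (h₁ : q ∈ JPlus (IsPSFutureCausal o r) p)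
    (h₂ : s ∈ JPlus (IsPSFutureCausal o r) q) : s ∈ JPlus (IsPSFutureCausal o r) p := by
  rcases h₁ with rfl | h₁
  · exact h₂
  rcases h₂ with rfl | h₂
  · exact Or.inr h₁
  · exact Or.inr (h₁.trans_ps h₂)

/-- A segment in a causal chart is a causal curve, if its direction is causal along the segment. -/
theorem IsCausalChart.mem_JPlus_of_segment [IsManifold (𝓡∂ n) r M] (hr : 1 ≤ r) {p : M}
    {V : EuclideanSpace ℝ (Fin n)} {ρ K κ : ℝ} (h : IsCausalChart o p V ρ K κ)
    {x y : EuclideanSpace ℝ (Fin n)}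
    (hx : x ∈ range (𝓡∂ n) ∩ Metric.ball (extChartAt (𝓡∂ n) p p) ρ)
    (hy : y ∈ range (𝓡∂ n) ∩ Metric.ball (extChartAt (𝓡∂ n) p p) ρ)
    (hxy : ∀ z ∈ segment ℝ x y, y - x ∈ causalCone (chartMetric g p z) V) :
    (extChartAt (𝓡∂ n) p).symm y ∈
      JPlus (IsPSFutureCausal o r) ((extChartAt (𝓡∂ n) p).symm x) := by
  by_cases hne : y - x = 0
  · left; rw [sub_eq_zero.1 hne]
  right
  set φ := extChartAt (𝓡∂ n) p with hφ
  set l : ℝ → EuclideanSpace ℝ (Fin n) := fun t => x + t • (y - x) with hl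
  have hseg : ∀ t ∈ Icc (0 : ℝ) 1, l t ∈ segment ℝ x y := fun t ht => by
    rw [segment_eq_image']; exact ⟨t, ht, rfl⟩
  have hmem : ∀ t ∈ Icc (0 : ℝ) 1, l t ∈ range (𝓡∂ n) ∩ Metric.ball (φ p) ρ := fun t ht =>
    h.model.convex.segment_subset hx hy (hseg t ht)
  have hsm : ContMDiffOn 𝓘(ℝ, ℝ) (𝓡∂ n) r (φ.symm ∘ l) (Icc 0 1) := by
    have hls : ContMDiffOn 𝓘(ℝ, ℝ) 𝓘(ℝ, EuclideanSpace ℝ (Fin n)) r l (Icc 0 1) :=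
      (contDiff_const.add (contDiff_id.smul contDiff_const)).contMDiff.contMDiffOn
    exact (contMDiffOn_extChartAt_symm p).comp hls fun t ht => h.subset_target (hmem t ht)
  refine ⟨φ.symm ∘ l, 0, 1, one_pos, .of_contMDiffOn one_pos hsm fun t ht => ?_, by simp [hl],
    by simp [hl]⟩
  have htar := h.subset_target (hmem t ht)
  have hsrc : (φ.symm ∘ l) t ∈ φ.source := φ.map_target htar
  have hφl : φ ((φ.symm ∘ l) t) = l t := φ.right_inv htar
  have hd := hasDerivWithinAt_extChartAt_comp hsrc
    ((hsm t ht).mdifferentiableWithinAt (by rintro rfl; simp at hr))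
  have hd' : HasDerivWithinAt (φ ∘ (φ.symm ∘ l)) (y - x) (Icc 0 1) t := by
    have h1 : HasDerivAt l (y - x) t := by
      have h2 := ((hasDerivAt_id t).smul_const (y - x)).const_add x
      rwa [one_smul] at h2
    exact h1.hasDerivWithinAt.congr_of_mem
      (fun s hs => φ.right_inv (h.subset_target (hmem s hs))) ht
  have hv := (uniqueDiffOn_Icc one_pos t ht).eq_deriv _ hd hd'
  rw [h.mem_futureCone _ hsrc (by rw [← hφ, hφl]; exact (hmem t ht).2), hv, ← hφ, hφl]
  exact ⟨hne, hxy _ (hseg t ht)⟩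

end PiecewiseSmooth

/-! ### `H¹`-causal curves -/

section SobolevCurves

variable {n : ℕ} [NeZero n]
variable {M : Type*} [TopologicalSpace M] [ChartedSpace (EuclideanHalfSpace n) M]
variable [IsManifold (𝓡∂ n) 1 M]
variable {g : LorentzMetric n M} {o : TimeOrientation g} {r : ℕ∞ω}

theorem mem_JMinus_iff {X : Type*} {C : (ℝ → X) → ℝ → ℝ → Prop} {p q : X} :
    q ∈ JMinus C p ↔ p ∈ JPlus C q :=
  or_congr_left eq_comm

/-- Every point has a neighbourhood which is contained in the causal past of a single point. -/
theorem exists_eventually_mem_JMinus [IsManifold (𝓡∂ n) r M] (hr : 1 ≤ r)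
    (hg : g.HasTimelikeBoundary) (q : M) :
    ∃ q', ∀ᶠ x in 𝓝 q, x ∈ JMinus (IsPSFutureCausal o r) q' := by
  obtain ⟨V, ρ, K, κ, h⟩ := exists_isCausalChart hg o q
  set φ := extChartAt (𝓡∂ n) q with hφ
  have hx₀ : φ q ∈ range (𝓡∂ n) := extChartAt_target_subset_range q (mem_extChartAt_target q)
  have hL := h.model.lorentz (φ q) ⟨hx₀, Metric.mem_ball_self h.pos⟩
  -- vectors close to `V` are causal at all points close to `q`
  have hev : ∀ᶠ zw : EuclideanSpace ℝ (Fin n) × EuclideanSpace ℝ (Fin n) in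
      𝓝[range (𝓡∂ n)] (φ q) ×ˢ 𝓝 V, zw.2 ∈ causalCone (chartMetric g q zw.1) V := by
    have hG := (contDiffWithinAt_chartMetric g q).continuousWithinAt.tendsto.comp
      (Filter.tendsto_fst (g := 𝓝 V))
    have hGV : Filter.Tendsto (fun zw : EuclideanSpace ℝ (Fin n) × EuclideanSpace ℝ (Fin n) =>
        chartMetric g q zw.1 V zw.2) (𝓝[range (𝓡∂ n)] (φ q) ×ˢ 𝓝 V)
        (𝓝 (chartMetric g q (φ q) V V)) :=
      (isBoundedBilinearMap_apply.continuous.tendsto _).comp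
        (((isBoundedBilinearMap_apply.continuous.tendsto _).comp
          (hG.prodMk_nhds (tendsto_const_nhds (x := V)))).prodMk_nhds Filter.tendsto_snd)
    have hGw : Filter.Tendsto (fun zw : EuclideanSpace ℝ (Fin n) × EuclideanSpace ℝ (Fin n) =>
        chartMetric g q zw.1 zw.2 zw.2) (𝓝[range (𝓡∂ n)] (φ q) ×ˢ 𝓝 V)
        (𝓝 (chartMetric g q (φ q) V V)) :=
      (isBoundedBilinearMap_apply.continuous.tendsto _).comp
        (((isBoundedBilinearMap_apply.continuous.tendsto _).comp
          (hG.prodMk_nhds Filter.tendsto_snd)).prodMk_nhds Filter.tendsto_snd)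
    filter_upwards [hGV.eventually (gt_mem_nhds hL.neg), hGw.eventually (gt_mem_nhds hL.neg)]
      with zw h1 h2 using ⟨h2.le, h1.le⟩
  obtain ⟨P, hP, Q, hQ, hPQ⟩ := Filter.eventually_prod_iff.1 hev
  obtain ⟨ρ₁, hρ₁, hP⟩ := Metric.mem_nhdsWithin_iff.1 hP
  obtain ⟨δ, hδ, hQ⟩ := Metric.mem_nhds_iff.1 hQ
  set ρ' := min ρ ρ₁ with hρ'
  have hρ'0 : 0 < ρ' := lt_min h.pos hρ₁
  have hcone : ∀ z ∈ range (𝓡∂ n) ∩ Metric.ball (φ q) ρ', ∀ w ∈ Metric.ball V δ,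
      w ∈ causalCone (chartMetric g q z) V := fun z hz w hw =>
    hPQ (hP ⟨Metric.ball_subset_ball (min_le_right _ _) hz.2, hz.1⟩) (hQ hw)
  have hsub : Metric.ball (φ q) ρ' ⊆ Metric.ball (φ q) ρ :=
    Metric.ball_subset_ball (min_le_left _ _)
  set ε := ρ' / (2 * (‖V‖ + 1)) with hε
  have hε0 : 0 < ε := by positivity
  have hy : φ q + ε • V ∈ Metric.ball (φ q) ρ' := by
    rw [mem_ball_iff_norm, add_sub_cancel_left, norm_smul, Real.norm_of_nonneg hε0.le, hε,
      div_mul_eq_mul_div, div_lt_iff₀ (by positivity)]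
    nlinarith [norm_nonneg V]
  have hy' : φ q + ε • V ∈ range (𝓡∂ n) := h.add_smul_mem _ hx₀ ε hε0.le (hsub hy)
  refine ⟨φ.symm (φ q + ε • V), ?_⟩
  have hcont : ContinuousAt φ q := continuousAt_extChartAt q
  filter_upwards [extChartAt_source_mem_nhds (I := 𝓡∂ n) q,
    hcont.tendsto.eventually (Metric.ball_mem_nhds _ hρ'0),
    hcont.tendsto.eventually (Metric.ball_mem_nhds _ (mul_pos hε0 hδ))] with x hx hx1 hx2
  have hxr : φ x ∈ range (𝓡∂ n) := extChartAt_target_subset_range q (φ.map_source hx)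
  rw [mem_JMinus_iff, ← φ.left_inv hx]
  refine h.mem_JPlus_of_segment hr ⟨hxr, hsub hx1⟩ ⟨hy', hsub hy⟩ fun z hz => ?_
  have hz' : z ∈ range (𝓡∂ n) ∩ Metric.ball (φ q) ρ' :=
    ((𝓡∂ n).convex_range.inter (convex_ball _ _)).segment_subset ⟨hxr, hx1⟩ ⟨hy', hy⟩ hz
  have hdir : φ q + ε • V - φ x = ε • (V + ε⁻¹ • (φ q - φ x)) := by
    rw [smul_add, smul_smul, mul_inv_cancel₀ hε0.ne', one_smul]; abel
  rw [hdir]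
  refine IsLorentzianWith.smul_mem (hcone z hz' _ ?_) hε0.le
  rw [mem_ball_iff_norm, add_sub_cancel_left, norm_smul, norm_inv, Real.norm_of_nonneg hε0.le,
    inv_mul_lt_iff₀ hε0, norm_sub_rev, ← dist_eq_norm]
  exact hx2

/-- Causal futures are closed: a point `q` in the closure of `J⁺(p)` belongs to the closure of the
compact set `J⁺(p) ∩ J⁻(q')`, if `J⁻(q')` is a neighbourhood of `q`. -/
theorem isClosed_JPlus [T2Space M] [IsManifold (𝓡∂ n) r M] (hr : 1 ≤ r)
    (hg : g.HasTimelikeBoundary) (hps : IsGloballyHyperbolic (IsPSFutureCausal o r)) (p : M) :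
    IsClosed (JPlus (IsPSFutureCausal o r) p) := by
  refine isClosed_of_closure_subset fun q hq => ?_
  obtain ⟨q', hq'⟩ := exists_eventually_mem_JMinus (o := o) hr hg q
  have h1 : q ∈ closure (JPlus (IsPSFutureCausal o r) p ∩ JMinus (IsPSFutureCausal o r) q') := by
    rw [mem_closure_iff_nhds] at hq ⊢
    intro t ht
    obtain ⟨x, hx, hxJ⟩ := hq _ (Filter.inter_mem ht hq')
    exact ⟨x, hx.1, hxJ, hx.2⟩
  rw [(hps.2 p q').isClosed.closure_eq] at h1
  exact h1.1

/-- Nearby points on an `H¹`-causal curve are related by piecewise smooth causal curves, because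
the later point is a limit of endpoints of causal polygons. -/
theorem IsH1FutureCausal.locally_mem_JPlus_ps [IsManifold (𝓡∂ n) r M] (hr : 1 ≤ r)
    (hg : g.HasTimelikeBoundary)
    (hclosed : ∀ p, IsClosed (JPlus (IsPSFutureCausal o r) p))
    {γ : ℝ → M} {a b t₀ : ℝ} (hγ : IsH1FutureCausal o r γ a b) (ht₀ : t₀ ∈ Icc a b) :
    ∃ δ > 0, ∀ s ∈ Icc a b, ∀ u ∈ Icc a b, |s - t₀| < δ → |u - t₀| < δ → s ≤ u →
      γ u ∈ JPlus (IsPSFutureCausal o r) (γ s) := by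
  obtain ⟨⟨hcont, hH1⟩, hvel⟩ := hγ
  obtain ⟨V, ρ, K, κ, h⟩ := exists_isCausalChart hg o (γ t₀)
  set φ := extChartAt (𝓡∂ n) (γ t₀) with hφ
  obtain ⟨δ, hδ, hδs⟩ : ∃ δ > 0, ∀ t ∈ Icc a b, |t - t₀| < δ →
      γ t ∈ φ.source ∧ φ (γ t) ∈ Metric.ball (φ (γ t₀)) (ρ / 2) := by
    have h1 := hcont t₀ ht₀
    have h2 : ContinuousAt φ (γ t₀) := continuousAt_extChartAt _
    have h3 := h1.tendsto.eventually ((extChartAt_source_mem_nhds (I := 𝓡∂ n) (γ t₀)))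
    have h4 := h1.tendsto.eventually (h2.tendsto.eventually
      (Metric.ball_mem_nhds _ (half_pos h.pos)))
    obtain ⟨δ, hδ, hs⟩ := Metric.mem_nhdsWithin_iff.1 (h3.and h4)
    exact ⟨δ, hδ, fun t ht htd => hs ⟨htd, ht⟩⟩
  set c := max a (t₀ - δ / 2) with hc
  set d := min b (t₀ + δ / 2) with hd
  have hct : c ≤ t₀ := max_le ht₀.1 (by linarith)
  have htd : t₀ ≤ d := le_min ht₀.2 (by linarith)
  have hcdab : Icc c d ⊆ Icc a b := Icc_subset_Icc (le_max_left _ _) (min_le_left _ _)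
  have hcdδ : ∀ t ∈ Icc c d, |t - t₀| < δ := fun t ht => by
    have h1 := (le_max_right a (t₀ - δ / 2)).trans ht.1
    have h2 := ht.2.trans (min_le_right b (t₀ + δ / 2))
    exact abs_lt.2 ⟨by linarith, by linarith⟩
  set f : ℝ → EuclideanSpace ℝ (Fin n) := φ ∘ γ with hf
  obtain ⟨hAC, hL2⟩ := hH1 _ (IsManifold.chart_mem_maximalAtlas (γ t₀)) c d (hct.trans htd) hcdab
    fun t ht => by
      have := (hδs t (hcdab ht) (hcdδ t ht)).1
      rwa [hφ, extChartAt_source] at this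
  change AbsolutelyContinuousOnInterval f c d at hAC
  change MemLp (deriv f) 2 _ at hL2
  have hint : IntervalIntegrable (deriv f) volume c d :=
    (intervalIntegrable_iff_integrableOn_Icc_of_le (hct.trans htd)).2
      (hL2.integrable (by norm_num))
  -- the primitive of the speed is continuous, so arcs near `t₀` are short
  set A : ℝ → ℝ := fun τ => ∫ t in c..τ, ‖deriv f t‖ with hA
  have hAcont : ContinuousOn A (Icc c d) := by
    rw [← uIcc_of_le (hct.trans htd)]
    exact intervalIntegral.continuousOn_primitive_interval (by
      rw [uIcc_of_le (hct.trans htd)]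
      exact (intervalIntegrable_iff_integrableOn_Icc_of_le (hct.trans htd)).1 hint.norm)
  set m := 1 / (4 * (K / κ * ‖V‖ + 1)) with hm
  have hKV : 0 ≤ K / κ * ‖V‖ :=
    mul_nonneg (div_nonneg h.model.nonneg h.model.pos.le) (norm_nonneg _)
  have hm0 : 0 < m := by positivity
  obtain ⟨δ₁, hδ₁, hAδ⟩ := Metric.continuousOn_iff.1 hAcont t₀ ⟨hct, htd⟩ m hm0
  refine ⟨min δ₁ (δ / 2), lt_min hδ₁ (half_pos hδ), fun s hs u hu hst hut hsu => ?_⟩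
  have hmem : ∀ t ∈ Icc a b, |t - t₀| < min δ₁ (δ / 2) → t ∈ Icc c d := fun t ht htt => by
    have := abs_lt.1 (htt.trans_le (min_le_right _ _))
    exact ⟨max_le ht.1 (by linarith), le_min ht.2 (by linarith)⟩
  have hs' := hmem s hs hst
  have hu' := hmem u hu hut
  have hsucd : Icc s u ⊆ Icc c d := Icc_subset_Icc hs'.1 hu'.2
  have hint_su : ∀ x ∈ Icc c d, ∀ y ∈ Icc c d, IntervalIntegrable (deriv f) volume x y :=
    fun x hx y hy => hint.mono_set (by
      rw [uIcc_of_le (hct.trans htd)]; exact uIcc_subset_Icc hx hy)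
  have hcc : c ∈ Icc c d := ⟨le_rfl, hct.trans htd⟩
  set ℓ := ∫ t in s..u, ‖deriv f t‖ with hℓ
  have hℓm : ℓ ≤ 2 * m := by
    have h1 : A u - A s = ℓ := intervalIntegral.integral_interval_sub_left
      (hint_su c hcc u hu').norm (hint_su c hcc s hs').norm
    have h2 := hAδ s hs' (hst.trans_le (min_le_left _ _))
    have h3 := hAδ u hu' (hut.trans_le (min_le_left _ _))
    rw [Real.dist_eq] at h2 h3
    linarith [(abs_lt.1 h2).1, (abs_lt.1 h3).2]
  have hfmem : ∀ t ∈ Icc c d, f t ∈ range (𝓡∂ n) ∩ Metric.ball (φ (γ t₀)) (ρ / 2) := fun t ht =>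
    have h1 := hδs t (hcdab ht) (hcdδ t ht)
    ⟨extChartAt_target_subset_range _ (φ.map_source h1.1), h1.2⟩
  have hball : Metric.ball (φ (γ t₀)) (ρ / 2) ⊆ Metric.ball (φ (γ t₀)) ρ :=
    Metric.ball_subset_ball (by linarith [h.pos])
  have hdiff : ∀ᵐ t ∂volume.restrict (Icc s u), DifferentiableAt ℝ f t ∧
      deriv f t ∈ causalCone (chartMetric g (γ t₀) (f t)) V := by
    have hsuab := hsucd.trans hcdab
    rw [← restrict_Ioo_eq_restrict_Icc]
    filter_upwards [ae_restrict_of_ae_restrict_of_subset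
      (Ioo_subset_Icc_self.trans hsuab) hvel, ae_restrict_mem measurableSet_Ioo] with t ht htsu
    have htcd := hsucd (Ioo_subset_Icc_self htsu)
    have hsrc := (hδs t (hcdab htcd) (hcdδ t htcd)).1
    have hder := hasDerivWithinAt_extChartAt_comp hsrc (mdifferentiableWithinAt_of_velocity_ne_zero
      fun h0 => zero_notMem_futureCone o _ (h0 ▸ ht))
    have hder' : HasDerivAt f _ t := hder.hasDerivAt
      (Icc_mem_nhds (hs.1.trans_lt htsu.1) (htsu.2.trans_le hu.2))
    refine ⟨hder'.differentiableAt, ?_⟩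
    rw [hder'.deriv]
    exact ((h.mem_futureCone _ hsrc (hball (hfmem t htcd).2) _).1 ht).2
  have hshort : K / κ * ‖V‖ * ℓ ≤ 1 / 2 := by
    have h1 := mul_le_mul_of_nonneg_left hℓm hKV
    have h2 : m * (4 * (K / κ * ‖V‖ + 1)) = 1 := one_div_mul_cancel (by positivity)
    nlinarith
  have hpoly : ∀ η : ℝ, 0 < η → η * ℓ * ‖V‖ < ρ / 2 →
      φ.symm (f u + (η * ℓ) • V) ∈ JPlus (IsPSFutureCausal o r) (γ s) := by
    intro η hη hηρ
    have key := h.model.rel_add_smul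
      (R := fun x y => φ.symm y ∈ JPlus (IsPSFutureCausal o r) (φ.symm x))
      (fun x => Or.inl rfl) (fun x y z => JPlus_trans_ps)
      (fun x hx y hy hxy => h.mem_JPlus_of_segment hr hx hy hxy) hsu
      (hAC.mono (by rw [uIcc_of_le hsu, uIcc_of_le (hct.trans htd)]; exact hsucd))
      (hint_su s hs' u hu') (fun t ht => ⟨(hfmem t (hsucd ht)).1, hball (hfmem t (hsucd ht)).2⟩)
      hdiff hshort hη (fun t ht l hl => ?_)
    · have : φ.symm (f s) = γ s := φ.left_inv (hδs s hs (hcdδ s hs')).1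
      simpa only [this] using key
    · have hft := hfmem t (hsucd ht)
      have hb : f t + l • V ∈ Metric.ball (φ (γ t₀)) ρ := by
        have h1 := hft.2
        rw [mem_ball_iff_norm] at h1 ⊢
        have h2 : f t + l • V - φ (γ t₀) = (f t - φ (γ t₀)) + l • V := by abel
        have h3 : ‖l • V‖ ≤ η * ℓ * ‖V‖ := by
          rw [norm_smul, Real.norm_of_nonneg hl.1]
          exact mul_le_mul_of_nonneg_right hl.2 (norm_nonneg _)
        rw [h2]
        calc _ ≤ ‖f t - φ (γ t₀)‖ + ‖l • V‖ := norm_add_le _ _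
          _ < ρ := by linarith
      exact ⟨h.add_smul_mem _ hft.1 l hl.1 hb, hb⟩
  -- let the polygons converge to the curve
  have hlim : Filter.Tendsto (fun η : ℝ => φ.symm (f u + (η * ℓ) • V)) (𝓝[>] 0) (𝓝 (γ u)) := by
    have hsrc := (hδs u hu (hcdδ u hu')).1
    have h1 : ContinuousAt φ.symm (f u) := continuousAt_extChartAt_symm' hsrc
    have h2 : Filter.Tendsto (fun η : ℝ => f u + (η * ℓ) • V) (𝓝 0) (𝓝 (f u)) := by
      have h3 : Continuous fun η : ℝ => f u + (η * ℓ) • V := by fun_prop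
      simpa using h3.tendsto 0
    have h3 := h1.tendsto.comp (h2.mono_left (nhdsWithin_le_nhds (s := Ioi 0)))
    rwa [show φ.symm (f u) = γ u from φ.left_inv hsrc] at h3
  refine (hclosed (γ s)).mem_of_tendsto hlim ?_
  have hη : ∀ᶠ η : ℝ in 𝓝[>] 0, η * ℓ * ‖V‖ < ρ / 2 := by
    have h3 : Continuous fun η : ℝ => η * ℓ * ‖V‖ := by fun_prop
    have h4 := (h3.tendsto 0).mono_left (nhdsWithin_le_nhds (s := Ioi 0))
    exact h4.eventually (gt_mem_nhds (by simpa using half_pos h.pos))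
  filter_upwards [hη, self_mem_nhdsWithin] with η h1 h2 using hpoly η h2 h1

/-- Points on an `H¹`-causal curve are related by piecewise smooth causal curves. -/
theorem IsH1FutureCausal.mem_JPlus_ps [IsManifold (𝓡∂ n) r M] (hr : 1 ≤ r)
    (hg : g.HasTimelikeBoundary)
    (hclosed : ∀ p, IsClosed (JPlus (IsPSFutureCausal o r) p))
    {γ : ℝ → M} {a b s u : ℝ} (hγ : IsH1FutureCausal o r γ a b) (has : a ≤ s) (hsu : s ≤ u)
    (hub : u ≤ b) : γ u ∈ JPlus (IsPSFutureCausal o r) (γ s) := by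
  have hsub : Icc s u ⊆ Icc a b := Icc_subset_Icc has hub
  refine rel_of_locally_rel (R := fun s u => γ u ∈ JPlus (IsPSFutureCausal o r) (γ s))
    (fun t => Or.inl rfl) (fun s t u => JPlus_trans_ps) hsu fun t ht => ?_
  obtain ⟨δ, hδ, h⟩ := hγ.locally_mem_JPlus_ps hr hg hclosed (hsub ht)
  exact ⟨δ, hδ, fun s' hs' u' hu' => h s' (hsub hs') u' (hsub hu')⟩

theorem IsH1FutureCausal.exists_ne {γ : ℝ → M} {a b : ℝ} (hγ : IsH1FutureCausal o r γ a b)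
    (hab : a < b) : ∃ t ∈ Icc a b, γ t ≠ γ a := by
  by_contra! hconst
  have hae : ∀ᵐ t ∂volume.restrict (Icc a b), False := by
    filter_upwards [hγ.2, ae_restrict_mem measurableSet_Icc] with t ht htab
    have h1 : HasMFDerivWithinAt 𝓘(ℝ, ℝ) (𝓡∂ n) γ (Icc a b) t 0 :=
      (hasMFDerivWithinAt_const (γ a) (Icc a b) t).congr_mono hconst (hconst t htab) Subset.rfl
    have h0 : velocity (n := n) γ a b t = 0 := by
      unfold velocity
      rw [h1.mfderivWithin_eq_zero]
      rfl
    rw [h0] at ht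
    exact zero_notMem_futureCone o _ ht
  rw [Filter.eventually_false_iff_eq_bot, ae_eq_bot, Measure.restrict_eq_zero,
    Real.volume_Icc, ENNReal.ofReal_eq_zero] at hae
  linarith

end SobolevCurves

/-! ### Piecewise smooth curves are `H¹`-curves -/

section PiecewiseSmoothIsSobolev

theorem lipschitzOnWith_of_Icc_union {E : Type*} [PseudoMetricSpace E] {f : ℝ → E} {K : NNReal}
    {S : Set ℝ} (hS : S.OrdConnected) {a b c : ℝ} (h₁ : LipschitzOnWith K f (S ∩ Icc a b))
    (h₂ : LipschitzOnWith K f (S ∩ Icc b c)) : LipschitzOnWith K f (S ∩ Icc a c) := by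
  have key : ∀ x ∈ S ∩ Icc a c, ∀ y ∈ S ∩ Icc a c, x ≤ y → dist (f x) (f y) ≤ K * dist x y := by
    intro x hx y hy hxy
    rcases le_total y b with hyb | hyb
    · exact h₁.dist_le_mul x ⟨hx.1, hx.2.1, hxy.trans hyb⟩ y ⟨hy.1, hy.2.1, hyb⟩
    rcases le_total b x with hxb | hxb
    · exact h₂.dist_le_mul x ⟨hx.1, hxb, hx.2.2⟩ y ⟨hy.1, hyb, hy.2.2⟩
    have hb : b ∈ S := hS.out hx.1 hy.1 ⟨hxb, hyb⟩
    have e1 := h₁.dist_le_mul x ⟨hx.1, hx.2.1, hxb⟩ b ⟨hb, hx.2.1.trans hxb, le_rfl⟩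
    have e2 := h₂.dist_le_mul b ⟨hb, le_rfl, hyb.trans hy.2.2⟩ y ⟨hy.1, hyb, hy.2.2⟩
    have e3 : dist x y = dist x b + dist b y := by
      rw [Real.dist_eq, Real.dist_eq, Real.dist_eq, abs_of_nonpos, abs_of_nonpos, abs_of_nonpos] <;>
        linarith
    rw [e3, mul_add]
    exact (dist_triangle _ (f b) _).trans (add_le_add e1 e2)
  refine LipschitzOnWith.of_dist_le_mul fun x hx y hy => ?_
  rcases le_total x y with h | h
  · exact key x hx y hy h
  · rw [dist_comm, dist_comm x]
    exact key y hy x hx h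

/-- A Lipschitz function belongs to `H¹`. -/
theorem isH1_of_lipschitzOnWith {n : ℕ} {f : ℝ → EuclideanSpace ℝ (Fin n)} {c d : ℝ} (hcd : c ≤ d)
    {K : NNReal} (h : LipschitzOnWith K f (Icc c d)) : IsH1 f c d := by
  refine ⟨LipschitzOnWith.absolutelyContinuousOnInterval (K := K) (by rwa [uIcc_of_le hcd]), ?_⟩
  refine MemLp.of_bound (aestronglyMeasurable_deriv _ _) K ?_
  rw [← restrict_Ioo_eq_restrict_Icc]
  filter_upwards [ae_restrict_mem measurableSet_Ioo] with t ht
  exact norm_deriv_le_of_lipschitzOn (Icc_mem_nhds ht.1 ht.2) h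

variable {n : ℕ} [NeZero n]
variable {M : Type*} [TopologicalSpace M] [ChartedSpace (EuclideanHalfSpace n) M]
variable [IsManifold (𝓡∂ n) 1 M]
variable {g : LorentzMetric n M} {o : TimeOrientation g} {r : ℕ∞ω}

/-- Piecewise smooth causal curves are `H¹`-causal, because they are Lipschitz in charts. -/
theorem IsPSFutureCausal.isH1FutureCausal [IsManifold (𝓡∂ n) r M] (hr : 1 ≤ r) {γ : ℝ → M}
    {a b : ℝ} (hγ : IsPSFutureCausal o r γ a b) : IsH1FutureCausal o r γ a b := by
  obtain ⟨m, t, rfl, rfl, h⟩ := hγ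
  have h0 : ∀ k ≤ m, t 0 ≤ t k := by
    intro k
    induction k with
    | zero => exact fun _ => le_rfl
    | succ k ih => exact fun hk => (ih (by omega)).trans (h k hk).1.le
  have hm : ∀ k ≤ m, t k ≤ t m := by
    intro k hk
    induction hk using Nat.decreasingInduction with
    | self => exact le_rfl
    | of_succ k hk ih => exact (h k hk).1.le.trans ih
  refine ⟨⟨?_, fun φ hφ c d hcd hsub hmaps => ?_⟩, ?_⟩
  · have key : ∀ k ≤ m, ContinuousOn γ (Icc (t 0) (t k)) := by
      intro k
      induction k with
      | zero => intro _; simp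
      | succ k ih =>
        intro hk
        rw [← Icc_union_Icc_eq_Icc (h0 k (by omega)) (h k hk).1.le]
        exact (ih (by omega)).union_of_isClosed (h k hk).2.1.continuousOn isClosed_Icc isClosed_Icc
    exact key m le_rfl
  · have key : ∀ k ≤ m, ∃ K, LipschitzOnWith K (φ.extend (𝓡∂ n) ∘ γ)
        (Icc c d ∩ Icc (t 0) (t k)) := by
      intro k
      induction k with
      | zero =>
        intro _
        refine ⟨0, fun x hx y hy => ?_⟩
        rw [Icc_self] at hx hy
        rw [hx.2, hy.2, edist_self]
        exact zero_le
      | succ k ih =>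
        intro hk
        obtain ⟨K₁, hK₁⟩ := ih (by omega)
        have hsm : ContDiffOn ℝ 1 (φ.extend (𝓡∂ n) ∘ γ) (Icc c d ∩ Icc (t k) (t (k + 1))) := by
          rw [← contMDiffOn_iff_contDiffOn]
          exact ((OpenPartialHomeomorph.contMDiffOn_extend hφ).comp
            ((h k hk).2.1.mono inter_subset_right)
            fun s hs => hmaps hs.1).of_le hr
        obtain ⟨K₂, hK₂⟩ := hsm.exists_lipschitzOnWith one_ne_zero
          ((convex_Icc _ _).inter (convex_Icc _ _)) (isCompact_Icc.inter isCompact_Icc)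
        exact ⟨max K₁ K₂, lipschitzOnWith_of_Icc_union ordConnected_Icc
          (hK₁.weaken (le_max_left _ _)) (hK₂.weaken (le_max_right _ _))⟩
    obtain ⟨K, hK⟩ := key m le_rfl
    rw [inter_eq_left.2 hsub] at hK
    exact isH1_of_lipschitzOnWith hcd hK
  · have key : ∀ s, ∀ k ≤ m, s ∈ Icc (t 0) (t k) →
        s = t 0 ∨ ∃ i < k, s ∈ Icc (t i) (t (i + 1)) := by
      intro s k
      induction k with
      | zero => exact fun _ hs => Or.inl (le_antisymm hs.2 hs.1)
      | succ k ih =>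
        intro hk hs
        rcases le_total s (t k) with hsk | hsk
        · rcases ih (by omega) ⟨hs.1, hsk⟩ with h' | ⟨i, hi, h'⟩
          · exact Or.inl h'
          · exact Or.inr ⟨i, by omega, h'⟩
        · exact Or.inr ⟨k, by omega, hsk, hs.2⟩
    -- away from the partition points, the velocities on `[a, b]` and on the subinterval agree
    have hnull : ∀ᵐ s ∂volume.restrict (Icc (t 0) (t m)), s ∉ range t :=
      ae_restrict_of_ae ((countable_range t).ae_notMem volume)
    filter_upwards [hnull, ae_restrict_mem measurableSet_Icc] with s hs hsab
    rcases key s m le_rfl hsab with rfl | ⟨i, hi, hsi⟩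
    · exact absurd (mem_range_self 0) hs
    have h1 : t i < s := lt_of_le_of_ne hsi.1 fun h' => hs ⟨i, h'⟩
    have h2 : s < t (i + 1) := lt_of_le_of_ne hsi.2 fun h' => hs ⟨i + 1, h'.symm⟩
    have hv := (h i hi).2.2 s hsi
    have e : velocity (n := n) γ (t 0) (t m) s = velocity γ (t i) (t (i + 1)) s := by
      unfold velocity
      rw [mfderivWithin_of_mem_nhds (Icc_mem_nhds h1 h2), mfderivWithin_of_mem_nhds
        (Icc_mem_nhds ((h0 i hi.le).trans_lt h1) (h2.trans_le (hm (i + 1) hi)))]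
    rwa [e]

end PiecewiseSmoothIsSobolev

end TimelikeBoundary

theorem proposition2p12
    {n : ℕ} [NeZero n] (hn : 2 ≤ n) {r : ℕ∞ω} (hr : 2 ≤ r)
    {M : Type*} [TopologicalSpace M] [T2Space M] [SecondCountableTopology M] [ConnectedSpace M]
    [ChartedSpace (EuclideanHalfSpace n) M] [IsManifold (𝓡∂ n) r M]
    -- implied by the previous instance and `hr`; needed for the tangent bundle
    [IsManifold (𝓡∂ n) 1 M]
    (g : TimelikeBoundary.LorentzMetric n M) (hg : g.HasTimelikeBoundary)
    (o : TimelikeBoundary.TimeOrientation g)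
    (hps : TimelikeBoundary.IsGloballyHyperbolic (TimelikeBoundary.IsPSFutureCausal o r)) :
    (∀ p : M,
      TimelikeBoundary.JPlus (TimelikeBoundary.IsPSFutureCausal o r) p =
        TimelikeBoundary.JPlus (TimelikeBoundary.IsH1FutureCausal o r) p ∧
      TimelikeBoundary.JMinus (TimelikeBoundary.IsPSFutureCausal o r) p =
        TimelikeBoundary.JMinus (TimelikeBoundary.IsH1FutureCausal o r) p) ∧
    TimelikeBoundary.IsGloballyHyperbolic (TimelikeBoundary.IsH1FutureCausal o r) := by
  have hr1 : 1 ≤ r := one_le_two.trans hr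
  have hclosed := TimelikeBoundary.isClosed_JPlus (o := o) hr1 hg hps
  have hplus : ∀ p : M, TimelikeBoundary.JPlus (TimelikeBoundary.IsPSFutureCausal o r) p =
      TimelikeBoundary.JPlus (TimelikeBoundary.IsH1FutureCausal o r) p := by
    intro p
    apply Subset.antisymm
    · rintro q (rfl | ⟨γ, a, b, hab, hγ, ha, hb⟩)
      · exact Or.inl rfl
      · exact Or.inr ⟨γ, a, b, hab, hγ.isH1FutureCausal hr1, ha, hb⟩
    · rintro q (rfl | ⟨γ, a, b, hab, hγ, rfl, rfl⟩)
      · exact Or.inl rfl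
      · exact hγ.mem_JPlus_ps hr1 hg hclosed le_rfl hab.le le_rfl
  have hminus : ∀ p : M, TimelikeBoundary.JMinus (TimelikeBoundary.IsPSFutureCausal o r) p =
      TimelikeBoundary.JMinus (TimelikeBoundary.IsH1FutureCausal o r) p := by
    intro p
    ext q
    rw [TimelikeBoundary.mem_JMinus_iff, TimelikeBoundary.mem_JMinus_iff, hplus]
  refine ⟨fun p => ⟨hplus p, hminus p⟩, ?_, fun p q => ?_⟩
  · rintro p ⟨γ, a, b, hab, hγ, rfl, hb⟩
    -- a closed curve passes through a second point, which lies in the future and in the past of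
    -- the first one
    obtain ⟨t, ht, hne⟩ := hγ.exists_ne hab
    have h1 := (hγ.mem_JPlus_ps hr1 hg hclosed le_rfl ht.1 ht.2).resolve_left hne
    have h2 := (hγ.mem_JPlus_ps hr1 hg hclosed ht.1 ht.2 le_rfl).resolve_left
      (by rw [hb]; exact hne.symm)
    rw [hb] at h2
    exact hps.1 _ (h1.trans_ps h2)
  · rw [← hplus, ← hminus]
    exact hps.2 p q
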